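/- **Setting.** Let $d\in\mathbb N_0$, let $\mathfrak L^-$ be a finite set and $\mathfrak L=\mathfrak L^-\sqcup\{0\}$. Fix a scaling $\mathfrak s=(\mathfrak s_1,\dots,\mathfrak s_d)\in[1,\infty)^d$, numbers $\eta>0$, $\alpha_{\mathfrak l},\mathrm{reg}(\mathfrak l)\in\mathbb R$ ($\mathfrak l\in\mathfrak L$) with $\alpha_0=0$ and $\mathrm{reg}(\mathfrak l)<\alpha_{\mathfrak l}$, and $r\in\mathbb R$ (the expected regularity of the solution) with $r\le \mathfrak s_i$ for all $i$. For $\mathbf n\in\mathbb N_0^d$ let $|\mathbf n|=\sum_i\mathfrak s_i\mathbf n(i)$. $M(I)$ denotes the set of finitely supported maps $I\to\mathbb N_0$, with unit vectors $e_\iota$, $\iota\in I$, and component-wise order. **Multi-indices.** Let $\mathcal R=(\mathfrak L\times M(\mathbb N_0^d))\sqcup\mathbb N_0^d$, with variables $\mathsf z_{(\mathfrak l,k)},\mathsf z_{\mathbf n}$. A pair $(\mathfrak l,k)$ is subcritical if $r<\eta+\mathrm{reg}(\mathfrak l)$ and, for all $0\neq k'\le k$, both $r<\eta+\sum_{\mathbf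 n}(r-|\mathbf n|)k'(\mathbf n)$ and $r<\eta+\mathrm{reg}(\mathfrak l)+\sum_{\mathbf n}(r-|\mathbf n|)k'(\mathbf n)$. For $\beta\in M(\mathcal R)$ put $$[\beta]=\sum_{(\mathfrak l,k)}\Big(1-\sum_{\mathbf n}k(\mathbf n)\Big)\beta(\mathfrak l,k)+\sum_{\mathbf n}\beta(\mathbf n),\qquad |\beta|=\sum_{(\mathfrak l,k)}\Big(\alpha_{\mathfrak l}+\sum_{\mathbf n}(\eta-|\mathbf n|)k(\mathbf n)\Big)\beta(\mathfrak l,k)+\sum_{\mathbf n}(|\mathbf n|-\eta)\beta(\mathbf n).$$ Let $\mathcal N_-$ be the set of $\beta$ with $[\beta]=1$, with $(\mathfrak l,k)$ subcritical whenever $\beta(\mathfrak l,k)\ne0$, and with $\beta(\mathbf n)=0$ whenever $|\mathbf n|<r$. Let $\mathcal N$ be the set of $\beta\in\mathcal N_-$ with $\sum_{\mathfrak l\in\mathfrak L^-}\sum_k\beta(\mathfrak l,k)>0$, let $\mathcal P=\{e_{\mathbf n}\}_{\mathbf n\in\mathbb N_0^d}$, and $\overline{\mathcal N}=\mathcal P\sqcup\mathcal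 N$. For a set $\mathcal V$ of multi-indices, $T_{\mathcal V}$ is the real vector space with basis $\{\mathsf z_\beta\}_{\beta\in\mathcal V}$. **Generators.** On $\mathbb R[\mathcal R]$ let $D^{(\mathbf n)}$ be the derivation with $D^{(\mathbf n)}\mathsf z_{(\mathfrak l,k)}=(k(\mathbf n)+1)\mathsf z_{(\mathfrak l,k+e_{\mathbf n})}$ if $(\mathfrak l,k+e_{\mathbf n})$ is subcritical and $=0$ otherwise, and $D^{(\mathbf n)}\mathsf z_{\mathbf m}=\delta_{\mathbf m\mathbf n}$; let $\boldsymbol\partial_i=\sum_{\mathbf n}(\mathbf n(i)+1)\mathsf z_{\mathbf n+e_i}D^{(\mathbf n)}$ (on each variable the sum is finite). Let $\mathcal M=\mathcal N\times\mathbb N_0^d$, let $L$ be the Lie algebra of derivations generated by $\{\mathsf z^\gamma D^{(\mathbf n)}\}_{(\gamma,\mathbf n)\in\mathcal M}\cup\{\boldsymbol\partial_i\}_{i=1}^d$, $\mathrm U(L)$ its universal enveloping algebra, and $\rho$ the action of $\mathrm U(L)$ on $\mathbb R[\mathcal R]$ that extends the action of the derivations. The linear maps $U\mapsto\mathsf z^\gamma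 U D^{(\mathbf n)}$ on $\mathrm U(L)$ are determined by $\mathsf z^\gamma 1D^{(\mathbf n)}=\mathsf z^\gamma D^{(\mathbf n)}$ and, for $E\in L$ with $E\mathsf z^\gamma=\sum_\beta E_\beta^\gamma \mathsf z^\beta$, by $\mathsf z^\gamma (EU) D^{(\mathbf n)}=E\,(\mathsf z^\gamma U D^{(\mathbf n)})-\sum_\beta E^\gamma_\beta\, \mathsf z^\beta U D^{(\mathbf n)}$; they commute. For $J\in M(\mathcal M)$, $\mathbf m\in\mathbb N_0^d$, let $\mathsf D_{(J,\mathbf m)}\in\mathrm U(L)$ be $\frac1{J!\,\mathbf m!}$ times the result of applying to $\boldsymbol\partial^{\mathbf m}=\prod_i\boldsymbol\partial_i^{\mathbf m(i)}$ each map $U\mapsto\mathsf z^\gamma UD^{(\mathbf n)}$ exactly $J(\gamma,\mathbf n)$ times, and define the coefficients $(\mathsf D_{(J,\mathbf m)})_\beta^\gamma$ by $\rho(\mathsf D_{(J,\mathbf m)})\mathsf z^\gamma=\sum_\beta(\mathsf D_{(J,\mathbf m)})_\beta^\gamma\,\mathsf z^\beta$. **Coaction.** Let $\mathcal M^+=\{(\gamma,\mathbf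 n)\in\mathcal M: |\mathbf n|<\eta+|\gamma|\}$ and $T^+=\mathbb R[\mathcal M^+\sqcup\{1,\dots,d\}]$, with monomials $\mathsf Z^{(J,\mathbf m)}$, $J\in M(\mathcal M^+)$, $\mathbf m\in\mathbb N_0^d$. Let $$\Delta^+\mathsf z_\beta=\sum_{J\in M(\mathcal M^+),\,\mathbf m\in\mathbb N_0^d,\,\gamma\in\overline{\mathcal N}\cup\mathcal N_-}(\mathsf D_{(J,\mathbf m)})_\beta^\gamma\;\mathsf Z^{(J,\mathbf m)}\otimes\mathsf z_\gamma,\qquad \beta\in\overline{\mathcal N}\cup\mathcal N_-,$$ and let $\overline{\Delta^+}:T_{\overline{\mathcal N}}\to T^+\otimes T_{\overline{\mathcal N}}$ be the restriction of $\Delta^+$ to $T_{\overline{\mathcal N}}$ followed by the projection of the second tensor factor onto $T_{\overline{\mathcal N}}$ (which discards the $\mathsf z_\gamma$ with $\gamma\notin\overline{\mathcal N}$). For a character (unital algebra morphism) $\boldsymbol\pi:T^+\to\mathbb R$ put $\Gamma^+_{\boldsymbol\pi}=(\boldsymbol\pi\otimes\mathrm{id})\overline{\Delta^+}\in\mathrm{End}(T_{\overline{\mathcal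 N}})$. **Statement.** For every $\beta\in\overline{\mathcal N}\cup\mathcal N_-$ only finitely many terms of $\Delta^+\mathsf z_\beta$ are non-zero, so that these maps are well-defined, and $$G=\{\Gamma^+_{\boldsymbol\pi}: \boldsymbol\pi \text{ a character of } T^+\}$$ is a group under composition and a structure group on $T_{\overline{\mathcal N}}$. That is: the set $A=\{|\beta|:\beta\in\mathcal N_-\}\cup\{|\beta|+\eta:\beta\in\overline{\mathcal N}\}\subset\mathbb R$ is bounded from below and locally finite; $T_{\overline{\mathcal N}}=\bigoplus_{\nu\in A}T_\nu$ where $T_\nu$ is the span of the $\mathsf z_\beta$, $\beta\in\overline{\mathcal N}$, with $|\beta|+\eta=\nu$; $G$ is a group of linear endomorphisms of $T_{\overline{\mathcal N}}$; and $\Gamma a-a\in\bigoplus_{\nu'<\nu}T_{\nu'}$ for all $\Gamma\in G$, $\nu\in A$, $a\in T_\nu$. Moreover, for every character $\boldsymbol\pi$ and all $\beta,\gamma\in\overline{\mathcal N}$, with $(\Gamma^+_{\boldsymbol\pi}-\mathrm{id})_\beta^\gamma$ the coefficient of $\mathsf z_\gamma$ in $(\Gamma^+_{\boldsymbol\pi}-\mathrm{id})\mathsf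 z_\beta$, $$(\Gamma^+_{\boldsymbol\pi}-\mathrm{id})_\beta^\gamma\neq0\ \Longrightarrow\ |\gamma|<|\beta|.$$ -/

import Mathlib

open scoped TensorProduct Nat

attribute [local instance 100] LieRing.ofAssociativeRing LieAlgebra.ofAssociativeAlgebra

noncomputable section

namespace MultiIndexRS

/-- Multi-indices over `I`: finitely supported maps `I → ℕ`. -/
abbrev MI (I : Type*) := I →₀ ℕ

/-- Indices of the coordinates `z_(l,k)` (left) and `z_n` (right).
`Option Λ` is the index set of the noises, with `none` for the additional index `0` of the
trivial noise `ξ₀ = 1`. -/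
abbrev Coord (d : ℕ) (Λ : Type*) := (Option Λ × MI (Fin d → ℕ)) ⊕ (Fin d → ℕ)

/-- The scaling data: the scaling `s` of `ℝ^d`, the order `η` of the operator, the homogeneities
`α` of the noises, and the regularities `reg`, `regsol` which define subcriticality.
The last field says that `|n| < regsol` happens for `n = 0` at most. -/
structure Setting (d : ℕ) (Λ : Type*) where
  s : Fin d → ℝ
  one_le_s : ∀ i, 1 ≤ s i
  η : ℝ
  η_pos : 0 < η
  α : Option Λ → ℝ
  α_none : α none = 0
  reg : Option Λ → ℝ
  reg_lt : ∀ l, reg l < α l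
  regsol : ℝ
  regsol_le : ∀ i, regsol ≤ s i

/-- The algebra of polynomials in the coordinates. -/
abbrev Poly (d : ℕ) (Λ : Type*) := MvPolynomial (Coord d Λ) ℝ

variable {d : ℕ} {Λ : Type*}

/-- `[β] = ∑ (1 - length k) β(l,k) + ∑ β(n)`. -/
def bracket (β : MI (Coord d Λ)) : ℤ :=
  β.sum fun x b => (b : ℤ) * Sum.elim (fun lk => 1 - ((lk.2.sum fun _ j => j : ℕ) : ℤ)) (fun _ => 1) x

/-- The noise homogeneity: the sum of `β(l,k)` over all `l ≠ 0` and all `k`. -/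
def noiseHom (β : MI (Coord d Λ)) : ℕ :=
  β.sum fun x b => b * Sum.elim (fun lk => if lk.1.isSome then 1 else 0) (fun _ => 0) x

namespace Setting

variable (S : Setting d Λ)

/-- The scaled degree `|n| = ∑ sᵢ n(i)`. -/
def deg (n : Fin d → ℕ) : ℝ := ∑ i, S.s i * n i

/-- The homogeneity `|β|`. -/
def hom (β : MI (Coord d Λ)) : ℝ :=
  β.sum fun x b => (b : ℝ) *
    Sum.elim (fun lk => S.α lk.1 + lk.2.sum fun n j => (S.η - S.deg n) * j)
      (fun n => S.deg n - S.η) x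

/-- `regsol < η + min {reg l, min_{0<k'≤k} ∑ (regsol - |n|) k'(n),
reg l + min_{0<k'≤k} ∑ (regsol - |n|) k'(n)}`. -/
def Subcritical (l : Option Λ) (k : MI (Fin d → ℕ)) : Prop :=
  S.regsol < S.η + S.reg l ∧
    ∀ k' : MI (Fin d → ℕ), k' ≠ 0 → k' ≤ k →
      S.regsol < S.η + (k'.sum fun n j => (S.regsol - S.deg n) * j) ∧
      S.regsol < S.η + (S.reg l + k'.sum fun n j => (S.regsol - S.deg n) * j)

/-- The large set `N₋` of multi-indices. -/
def NMin : Set (MI (Coord d Λ)) :=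
  {β | bracket β = 1 ∧ (∀ l k, β (Sum.inl (l, k)) ≠ 0 → S.Subcritical l k) ∧
    ∀ n, S.deg n < S.regsol → β (Sum.inr n) = 0}

/-- The multi-indices in `N₋` which contain a noise. -/
def N : Set (MI (Coord d Λ)) := {β | β ∈ S.NMin ∧ 0 < noiseHom β}

/-- The purely polynomial multi-indices `e_n`. -/
def P (d : ℕ) (Λ : Type*) : Set (MI (Coord d Λ)) :=
  Set.range fun n => Finsupp.single (Sum.inr n) 1

/-- The populated multi-indices `P ⊔ N`. -/
def Pop : Set (MI (Coord d Λ)) := P d Λ ∪ S.N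

open Classical in
/-- The derivation `D^(n)`, restricted to subcritical pairs:
`D^(n) z_(l,k) = (k(n)+1) z_(l,k+e_n)` if `(l,k+e_n)` is subcritical, and `0` otherwise;
`D^(n) z_m = δ_{mn}`. -/
def D (n : Fin d → ℕ) : Derivation ℝ (Poly d Λ) (Poly d Λ) :=
  MvPolynomial.mkDerivation ℝ <| Sum.elim
    (fun lk => if S.Subcritical lk.1 (lk.2 + Finsupp.single n 1) then
      ((lk.2 n : ℝ) + 1) • MvPolynomial.X (Sum.inl (lk.1, lk.2 + Finsupp.single n 1)) else 0)
    (fun m => if m = n then 1 else 0)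

/-- The derivation `∂ᵢ = ∑_n (n(i)+1) z_{n+eᵢ} D^(n)`. On each coordinate only finitely many `n`
contribute, since a subcritical `(l,k+e_n)` has `|n| < η`. -/
def dx (i : Fin d) : Derivation ℝ (Poly d Λ) (Poly d Λ) :=
  MvPolynomial.mkDerivation ℝ fun x => ∑ᶠ n : Fin d → ℕ,
    ((n i : ℝ) + 1) • (MvPolynomial.X (Sum.inr (n + Pi.single i 1)) * S.D n (MvPolynomial.X x))

/-- The generators `z^γ D^(n)` with `γ ∈ N`, and `∂ᵢ`. -/
def gens : Set (Derivation ℝ (Poly d Λ) (Poly d Λ)) :=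
  {E | ∃ γ ∈ S.N, ∃ n, E = MvPolynomial.monomial γ (1 : ℝ) • S.D n} ∪ Set.range S.dx

/-- The Lie algebra `L` generated by the generators. -/
abbrev L : LieSubalgebra ℝ (Derivation ℝ (Poly d Λ) (Poly d Λ)) :=
  LieSubalgebra.lieSpan ℝ _ S.gens

/-- The universal enveloping algebra of `L`. -/
abbrev UL := UniversalEnvelopingAlgebra ℝ S.L

/-- The linear span of the monomials `z^γ`, `γ ∈ N`. -/
abbrev TN : Submodule ℝ (Poly d Λ) := MvPolynomial.restrictSupport ℝ S.N

/-! ### `L` maps `TN` to itself -/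

theorem monomial_mem {γ : MI (Coord d Λ)} (h : γ ∈ S.N) (c : ℝ) :
    MvPolynomial.monomial γ c ∈ S.TN := by
  rw [MvPolynomial.mem_restrictSupport_iff]
  intro x hx
  have := MvPolynomial.support_monomial_subset hx
  simp only [Finset.mem_singleton] at this
  exact this ▸ h

theorem mem_N_iff (β : MI (Coord d Λ)) : β ∈ S.N ↔ bracket β = 1 ∧ 0 < noiseHom β ∧
    (∀ l k, β (Sum.inl (l, k)) ≠ 0 → S.Subcritical l k) ∧
    ∀ n, S.deg n < S.regsol → β (Sum.inr n) = 0 := by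
  simp only [N, NMin, Set.mem_ofPred_eq]; tauto

theorem bracket_add (β γ : MI (Coord d Λ)) : bracket (β + γ) = bracket β + bracket γ := by
  classical
  unfold bracket
  rw [Finsupp.sum_add_index'] <;> intros <;> push_cast <;> ring

theorem noiseHom_add (β γ : MI (Coord d Λ)) : noiseHom (β + γ) = noiseHom β + noiseHom γ := by
  classical
  unfold noiseHom
  rw [Finsupp.sum_add_index'] <;> intros <;> ring

theorem bracket_inl (l : Option Λ) (k : MI (Fin d → ℕ)) :
    bracket (Finsupp.single (Sum.inl (l, k)) 1) = 1 - ((k.sum fun _ j => j : ℕ) : ℤ) := by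
  simp [bracket]

theorem bracket_inr (n : Fin d → ℕ) :
    bracket (Finsupp.single (Sum.inr n : Coord d Λ) 1) = 1 := by
  simp [bracket]

theorem noiseHom_inl (l : Option Λ) (k k' : MI (Fin d → ℕ)) :
    noiseHom (Finsupp.single (Sum.inl (l, k) : Coord d Λ) 1) =
      noiseHom (Finsupp.single (Sum.inl (l, k') : Coord d Λ) 1) := by
  simp [noiseHom]

theorem noiseHom_inr (n : Fin d → ℕ) :
    noiseHom (Finsupp.single (Sum.inr n : Coord d Λ) 1) = 0 := by
  simp [noiseHom]

theorem length_add_single (k : MI (Fin d → ℕ)) (n : Fin d → ℕ) :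
    ((k + Finsupp.single n 1).sum fun _ j => j) = (k.sum fun _ j => j) + 1 := by
  classical
  rw [Finsupp.sum_add_index'] <;> simp

/-- Replacing `(l,k)` by `(l,k+e_n)` and multiplying by `z^μ` with `[μ] = 1`. -/
theorem mem_N_of_inl {δ μ : MI (Coord d Λ)} {l : Option Λ} {k : MI (Fin d → ℕ)} {n : Fin d → ℕ}
    (h : δ + Finsupp.single (Sum.inl (l, k)) 1 ∈ S.N) (hμ : bracket μ = 1)
    (hs : ∀ l k, μ (Sum.inl (l, k)) ≠ 0 → S.Subcritical l k)
    (hn : ∀ n, S.deg n < S.regsol → μ (Sum.inr n) = 0)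
    (hk : S.Subcritical l (k + Finsupp.single n 1)) :
    μ + δ + Finsupp.single (Sum.inl (l, k + Finsupp.single n 1)) 1 ∈ S.N := by
  classical
  rw [mem_N_iff] at h ⊢
  obtain ⟨h1, h2, h3, h4⟩ := h
  rw [bracket_add, bracket_inl] at h1
  rw [noiseHom_add] at h2
  refine ⟨?_, ?_, ?_, ?_⟩
  · rw [bracket_add, bracket_add, bracket_inl, length_add_single, hμ, Nat.cast_add, Nat.cast_one]
    linarith
  · rw [noiseHom_add, noiseHom_add, noiseHom_inl l _ k]; omega
  · intro l' k' h'
    by_cases hμ' : μ (Sum.inl (l', k')) = 0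
    · by_cases hδ : δ (Sum.inl (l', k')) = 0
      · simp only [Finsupp.add_apply, hμ', hδ, Finsupp.single_apply] at h'
        split_ifs at h' with he
        · simp only [Sum.inl.injEq, Prod.mk.injEq] at he
          rw [← he.1, ← he.2]; exact hk
        · simp at h'
      · exact h3 _ _ (by simp [hδ])
    · exact hs _ _ hμ'
  · intro n' hn'
    have := h4 n' hn'
    simp only [Finsupp.add_apply] at this
    simp only [Finsupp.add_apply, hn n' hn', Finsupp.single_apply, reduceCtorEq, if_false]
    omega

/-- Removing `e_n` and multiplying by `z^μ` with `[μ] = 1`. -/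
theorem mem_N_of_inr {δ μ : MI (Coord d Λ)} {n : Fin d → ℕ}
    (h : δ + Finsupp.single (Sum.inr n) 1 ∈ S.N) (hμ : bracket μ = 1)
    (hs : ∀ l k, μ (Sum.inl (l, k)) ≠ 0 → S.Subcritical l k)
    (hn : ∀ n, S.deg n < S.regsol → μ (Sum.inr n) = 0) : μ + δ ∈ S.N := by
  classical
  rw [mem_N_iff] at h ⊢
  obtain ⟨h1, h2, h3, h4⟩ := h
  rw [bracket_add, bracket_inr] at h1
  rw [noiseHom_add, noiseHom_inr] at h2
  refine ⟨?_, ?_, ?_, ?_⟩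
  · rw [bracket_add, hμ]; linarith
  · rw [noiseHom_add]; omega
  · intro l' k' h'
    by_cases hμ' : μ (Sum.inl (l', k')) = 0
    · refine h3 _ _ ?_
      simp only [Finsupp.add_apply] at h' ⊢
      omega
    · exact hs _ _ hμ'
  · intro n' hn'
    have := h4 n' hn'
    simp only [Finsupp.add_apply] at this
    simp only [Finsupp.add_apply, hn n' hn']
    omega

/-- `z^μ D^(n)` maps the coordinate `x`, multiplied by `z^δ`, to `TN`. -/
theorem D_X_mem {δ μ : MI (Coord d Λ)} {x : Coord d Λ} (n : Fin d → ℕ)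
    (h : δ + Finsupp.single x 1 ∈ S.N) (hμ : bracket μ = 1)
    (hs : ∀ l k, μ (Sum.inl (l, k)) ≠ 0 → S.Subcritical l k)
    (hn : ∀ n, S.deg n < S.regsol → μ (Sum.inr n) = 0) (c : ℝ) :
    MvPolynomial.monomial (μ + δ) c * S.D n (MvPolynomial.X x) ∈ S.TN := by
  classical
  rcases x with ⟨l, k⟩ | m
  · simp only [D, MvPolynomial.mkDerivation_X, Sum.elim_inl]
    split_ifs with hk
    · rw [mul_smul_comm, MvPolynomial.X, MvPolynomial.monomial_mul]
      exact Submodule.smul_mem _ _ (S.monomial_mem (S.mem_N_of_inl h hμ hs hn hk) _)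
    · simp
  · simp only [D, MvPolynomial.mkDerivation_X, Sum.elim_inr]
    split_ifs with hm
    · rw [mul_one]
      exact S.monomial_mem (S.mem_N_of_inr h hμ hs hn) _
    · simp

theorem deriv_mem (E : Derivation ℝ (Poly d Λ) (Poly d Λ))
    (hE : ∀ (δ : MI (Coord d Λ)) (x : Coord d Λ), δ + Finsupp.single x 1 ∈ S.N → ∀ c : ℝ,
      MvPolynomial.monomial δ c * E (MvPolynomial.X x) ∈ S.TN)
    {f : Poly d Λ} (hf : f ∈ S.TN) : E f ∈ S.TN := by
  classical
  rw [MvPolynomial.as_sum f, map_sum]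
  refine Submodule.sum_mem _ fun γ hγ => ?_
  have hγN : γ ∈ S.N := (MvPolynomial.mem_restrictSupport_iff _).1 hf hγ
  have hE' : E = MvPolynomial.mkDerivation ℝ fun x => E (MvPolynomial.X x) :=
    MvPolynomial.derivation_ext fun x => by rw [MvPolynomial.mkDerivation_X]
  rw [hE', MvPolynomial.mkDerivation_monomial]
  refine Submodule.smul_mem _ _ (Submodule.sum_mem _ fun x hx => ?_)
  simp only [smul_eq_mul]
  refine hE _ _ ?_ _
  have : γ - Finsupp.single x 1 + Finsupp.single x 1 = γ := by
    refine tsub_add_cancel_of_le ?_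
    rw [Finsupp.single_le_iff]
    exact Nat.one_le_iff_ne_zero.2 (Finsupp.mem_support_iff.1 hx)
  rwa [this]

theorem deg_add (n : Fin d → ℕ) (i : Fin d) : S.s i ≤ S.deg (n + Pi.single i 1) := by
  classical
  unfold deg
  have h0 : ∀ j ∈ Finset.univ, 0 ≤ S.s j * ((n + Pi.single i 1 : Fin d → ℕ) j : ℝ) :=
    fun j _ => mul_nonneg (zero_le_one.trans (S.one_le_s j)) (Nat.cast_nonneg _)
  refine le_trans ?_ (Finset.single_le_sum h0 (Finset.mem_univ i))
  have : (1 : ℝ) ≤ ((n + Pi.single i 1 : Fin d → ℕ) i : ℝ) := by simp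
  nlinarith [S.one_le_s i]

theorem gens_mem {E : Derivation ℝ (Poly d Λ) (Poly d Λ)} (hE : E ∈ S.gens)
    {f : Poly d Λ} (hf : f ∈ S.TN) : E f ∈ S.TN := by
  classical
  rcases hE with ⟨γ, hγ, n, rfl⟩ | ⟨i, rfl⟩
  · refine S.deriv_mem _ (fun δ x h c => ?_) hf
    obtain ⟨h1, -, h3, h4⟩ := (S.mem_N_iff γ).1 hγ
    have := S.D_X_mem (x := x) n h h1 h3 h4 c
    rwa [Derivation.smul_apply, smul_eq_mul, ← mul_assoc, MvPolynomial.monomial_mul, mul_one,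
      add_comm δ γ]
  · refine S.deriv_mem _ (fun δ x h c => ?_) hf
    rw [dx, MvPolynomial.mkDerivation_X]
    refine finsum_induction (fun p => MvPolynomial.monomial δ c * p ∈ S.TN) (by simp)
      (fun p q hp hq => by rw [mul_add]; exact Submodule.add_mem _ hp hq) (fun n => ?_)
    rw [mul_smul_comm, ← mul_assoc, MvPolynomial.X, MvPolynomial.monomial_mul, mul_one, add_comm δ]
    refine Submodule.smul_mem _ _ (S.D_X_mem (x := x) n h (bracket_inr _) ?_ ?_ c)
    · intro l k h'
      simp at h'
    · intro m hm
      rw [Finsupp.single_apply, if_neg]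
      rintro h'
      rw [Sum.inr.injEq] at h'
      subst h'
      exact absurd hm (not_lt.2 ((S.regsol_le i).trans (S.deg_add n i)))

theorem L_mem {E : Derivation ℝ (Poly d Λ) (Poly d Λ)} (hE : E ∈ S.L) :
    ∀ {f : Poly d Λ}, f ∈ S.TN → E f ∈ S.TN := by
  induction hE using LieSubalgebra.lieSpan_induction with
  | mem x hx => exact fun hf => S.gens_mem hx hf
  | zero => intro f _; simp
  | smul a x _ h => intro f hf; simpa using Submodule.smul_mem _ a (h hf)
  | add x y _ _ hx hy => intro f hf; simpa using Submodule.add_mem _ (hx hf) (hy hf)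
  | lie x y _ _ hx hy =>
    intro f hf
    rw [Derivation.commutator_apply]
    exact Submodule.sub_mem _ (hx (hy hf)) (hy (hx hf))

theorem smul_D_mem (n : Fin d → ℕ) {f : Poly d Λ} (hf : f ∈ S.TN) : f • S.D n ∈ S.L := by
  rw [MvPolynomial.as_sum f, Finset.sum_smul]
  refine Submodule.sum_mem S.L.toSubmodule fun γ hγ => ?_
  have hγN : γ ∈ S.N := (MvPolynomial.mem_restrictSupport_iff _).1 hf hγ
  have : MvPolynomial.monomial γ (f.coeff γ) • S.D n =
      f.coeff γ • (MvPolynomial.monomial γ (1 : ℝ) • S.D n) := by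
    rw [← smul_assoc, MvPolynomial.smul_monomial, smul_eq_mul, mul_one]
  rw [this]
  exact Submodule.smul_mem _ _ (LieSubalgebra.subset_lieSpan (Or.inl ⟨γ, hγN, n, rfl⟩))

/-! ### The universal enveloping algebra, its action and its basis -/

/-- `∂ᵢ` as an element of `L`. -/
def dxL (i : Fin d) : S.L := ⟨S.dx i, LieSubalgebra.subset_lieSpan (Or.inr ⟨i, rfl⟩)⟩

/-- The linear map `f ↦ f D^(n)` from `TN` to the universal enveloping algebra. -/
def smulD (n : Fin d → ℕ) : S.TN →ₗ[ℝ] S.UL :=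
  (UniversalEnvelopingAlgebra.ι ℝ : S.L →ₗ⁅ℝ⁆ S.UL).toLinearMap ∘ₗ
    { toFun := fun f => (⟨(f : Poly d Λ) • S.D n, S.smul_D_mem n f.2⟩ : S.L)
      map_add' := fun f g => Subtype.ext (by simp [add_smul])
      map_smul' := fun c f => Subtype.ext (by simp) }

/-- The action of `L` on `TN`. -/
def actTN (E : S.L) : S.TN →ₗ[ℝ] S.TN :=
  (E : Derivation ℝ (Poly d Λ) (Poly d Λ)).toLinearMap.restrict fun _ hf => S.L_mem E.2 hf

/-- The action `E · u = (f ↦ E u(f) - u(E f))` of `L` on linear maps from `TN` to its universal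
enveloping algebra. -/
def leibnizAction : S.L →ₗ⁅ℝ⁆ Module.End ℝ (S.TN →ₗ[ℝ] S.UL) where
  toFun E :=
    { toFun := fun u =>
        LinearMap.mulLeft ℝ (UniversalEnvelopingAlgebra.ι ℝ E : S.UL) ∘ₗ u - u ∘ₗ S.actTN E
      map_add' := fun u v => by ext f; simp [mul_add]; abel
      map_smul' := fun c u => by ext f; simp [smul_sub] }
  map_add' E F := by
    ext u f
    have : S.actTN (E + F) f = S.actTN E f + S.actTN F f := Subtype.ext (by simp [actTN])
    simp [add_mul, this]; abel
  map_smul' c E := by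
    ext u f
    have : S.actTN (c • E) f = c • S.actTN E f := Subtype.ext (by simp [actTN])
    simp [this, smul_sub]
  map_lie' {E F} := by
    ext u f
    have : S.actTN ⁅E, F⁆ f = S.actTN E (S.actTN F f) - S.actTN F (S.actTN E f) :=
      Subtype.ext (by simp [actTN, LieRing.of_associative_ring_bracket])
    simp [this, LieRing.of_associative_ring_bracket, sub_mul, mul_sub, mul_assoc]
    abel

/-- `insertD n U f` is the element `f U D^(n)`. It is determined by `f 1 D^(n) = f D^(n)` and
`f (E U) D^(n) = E (f U D^(n)) - (E f) U D^(n)` for `E ∈ L`. -/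
def insertD (n : Fin d → ℕ) (U : S.UL) : S.TN →ₗ[ℝ] S.UL :=
  UniversalEnvelopingAlgebra.lift ℝ S.leibnizAction U (S.smulD n)

theorem insertD_one (n : Fin d → ℕ) (f : S.TN) : S.insertD n 1 f = S.smulD n f := by
  simp [insertD]

theorem insertD_ι_mul (n : Fin d → ℕ) (E : S.L) (U : S.UL) (f : S.TN) :
    S.insertD n (UniversalEnvelopingAlgebra.ι ℝ E * U) f =
      UniversalEnvelopingAlgebra.ι ℝ E * S.insertD n U f - S.insertD n U (S.actTN E f) := by
  simp [insertD, leibnizAction]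

/-- The index set `N × ℕ^d` of the generators `z^γ D^(n)`. -/
abbrev M := S.N × (Fin d → ℕ)

/-- The map `U ↦ z^γ U D^(n)`. -/
def insertGen (p : S.M) (U : S.UL) : S.UL :=
  S.insertD p.2 U ⟨MvPolynomial.monomial p.1.1 1, S.monomial_mem p.1.2 1⟩

/-- `∂^m = ∏ᵢ ∂ᵢ^{m(i)}`; the factors commute. -/
def dxPow (m : Fin d → ℕ) : S.UL :=
  (List.ofFn fun i => (UniversalEnvelopingAlgebra.ι ℝ (S.dxL i) : S.UL) ^ m i).prod

/-- The basis element
`D_(J,m) = 1/(J! m!) ∏ (z^γ)^{J(γ,n)} ∂^m ∏ (D^(n))^{J(γ,n)}`, obtained from `∂^m` by applying each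
of the commuting maps `U ↦ z^γ U D^(n)` exactly `J(γ,n)` times. -/
def DJm (J : MI S.M) (m : Fin d → ℕ) : S.UL :=
  (((J.prod fun _ j => j !) * ∏ i, (m i)! : ℕ) : ℝ)⁻¹ •
    (Finsupp.toMultiset J).toList.foldr S.insertGen (S.dxPow m)

/-- The action of `U(L)` on polynomials which extends the action of the derivations. -/
def rho : S.UL →ₐ[ℝ] Module.End ℝ (Poly d Λ) :=
  UniversalEnvelopingAlgebra.lift ℝ
    { toFun := fun E => (E : Derivation ℝ (Poly d Λ) (Poly d Λ)).toLinearMap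
      map_add' := fun _ _ => rfl
      map_smul' := fun _ _ => rfl
      map_lie' := fun {_ _} => Derivation.commutator_coe_linear_map }

/-- The coefficient `(D_(J,m))_β^γ`, that is, `ρ(D_(J,m)) z^γ = ∑_β (D_(J,m))_β^γ z^β`. -/
def actCoeff (J : MI S.M) (m : Fin d → ℕ) (β γ : MI (Coord d Λ)) : ℝ :=
  (S.rho (S.DJm J m) (MvPolynomial.monomial γ 1)).coeff β

/-! ### The coaction and the structure group -/

/-- The pairs `(γ,n)` with `γ ∈ N` and `|n| < η + |γ|`. -/
abbrev MPlus := {p : S.M // S.deg p.2 < S.η + S.hom p.1}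

/-- The algebra `T⁺` of polynomials in the variables `Z_(γ,n)` and `Zᵢ`. -/
abbrev TPlus := MvPolynomial (S.MPlus ⊕ Fin d) ℝ

/-- The monomial `Z^(J,m)`. -/
def ZMon (J : MI S.MPlus) (m : Fin d → ℕ) : S.TPlus :=
  (J.prod fun p j => MvPolynomial.X (Sum.inl p) ^ j) * ∏ i, MvPolynomial.X (Sum.inr i) ^ m i

/-- The coefficients of the action for `J` supported in `MPlus`. -/
def actCoeffPlus (J : MI S.MPlus) (m : Fin d → ℕ) (β γ : MI (Coord d Λ)) : ℝ :=
  S.actCoeff (J.mapDomain Subtype.val) m β γ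

/-- All multi-indices under consideration: `P ⊔ N` together with `N₋`. -/
abbrev All : Set (MI (Coord d Λ)) := S.Pop ∪ S.NMin

/-- The vector space with basis `z_β`, `β ∈ P ⊔ N ∪ N₋`. -/
abbrev TAll := S.All →₀ ℝ

/-- The model space with basis `z_β`, `β ∈ P ⊔ N`. -/
abbrev TPop := S.Pop →₀ ℝ

/-- The coaction `Δ⁺ z_β = ∑_{(J,m),γ} (D_(J,m))_β^γ Z^(J,m) ⊗ z_γ`. -/
def coaction : S.TAll →ₗ[ℝ] S.TPlus ⊗[ℝ] S.TAll :=
  Finsupp.linearCombination ℝ fun β : S.All =>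
    ∑ᶠ q : (MI S.MPlus × (Fin d → ℕ)) × S.All,
      S.actCoeffPlus q.1.1 q.1.2 β q.2 • (S.ZMon q.1.1 q.1.2 ⊗ₜ[ℝ] Finsupp.single q.2 (1 : ℝ))

/-- The inclusion of `P ⊔ N`. -/
def popIncl : S.Pop → S.All := fun β => ⟨β.1, Or.inl β.2⟩

/-- The projection onto the span of the `z_β` with `β ∈ P ⊔ N`. -/
def projPop : S.TAll →ₗ[ℝ] S.TPop :=
  Finsupp.lcomapDomain S.popIncl fun _ _ h => Subtype.ext (congrArg (fun x : S.All => x.1) h)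

/-- The projected coaction, restricted to `TPop`. -/
def projCoaction : S.TPop →ₗ[ℝ] S.TPlus ⊗[ℝ] S.TPop :=
  S.projPop.lTensor S.TPlus ∘ₗ S.coaction ∘ₗ Finsupp.lmapDomain ℝ ℝ S.popIncl

/-- `Γ⁺_π = (π ⊗ id) Δ⁺` (projected) for a character `π` of `T⁺`. -/
def Gam (π : S.TPlus →ₐ[ℝ] ℝ) : Module.End ℝ S.TPop :=
  (TensorProduct.lid ℝ S.TPop).toLinearMap ∘ₗ π.toLinearMap.rTensor S.TPop ∘ₗ S.projCoaction

/-- The set `G` of all `Γ⁺_π`. -/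
def G : Set (Module.End ℝ S.TPop) := Set.range S.Gam

/-- The set of homogeneities
`A = {|β| : β ∈ N₋} ∪ {|β| + η : β ∈ P ⊔ N}`. -/
def A : Set ℝ := S.hom '' S.NMin ∪ (fun β => S.hom β + S.η) '' S.Pop

/-- The homogeneous part of degree `ν` of the model space, `z_β` having degree `|β| + η`. -/
def graded (ν : S.A) : Submodule ℝ S.TPop :=
  Finsupp.supported ℝ ℝ {β : S.Pop | S.hom β + S.η = ν}

end Setting

/-- Regularity structures `(A, T, G)`: the set `A` of homogeneities is bounded from below and
locally finite, the model space `V` is the direct sum of the `T ν`, `ν ∈ A`, and `G` is a group of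
linear endomorphisms of `V` with `Γ a - a ∈ ⨁_{ν' < ν} T ν'` for all `Γ ∈ G` and `a ∈ T ν`. -/
structure IsRegularityStructure {V : Type*} [AddCommGroup V] [Module ℝ V] (A : Set ℝ)
    (T : A → Submodule ℝ V) (G : Set (Module.End ℝ V)) : Prop where
  bddBelow : BddBelow A
  locallyFinite : ∀ a b : ℝ, (A ∩ Set.Icc a b).Finite
  isInternal : DirectSum.IsInternal T
  isGroup : ∃ H : Subgroup (Module.End ℝ V)ˣ, G = Units.val '' (H : Set (Module.End ℝ V)ˣ)
  triangular : ∀ Γ ∈ G, ∀ ν : A, ∀ a ∈ T ν, Γ a - a ∈ ⨆ ν' : A, ⨆ _ : ν' < ν, T ν'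

end MultiIndexRS

end

noncomputable section

namespace MultiIndexRS

variable {d : ℕ} {Λ : Type*}

/-! ### Taylor coefficients of shifted monomials -/

section Taylor

variable {ι A : Type*} [CommRing A]

/-! The coefficients of the operators `DJm J m` are the Taylor coefficients, in the variables of
`TPlus`, of one explicit algebra morphism, a translation of the coordinates. It sends `z_n` to a
series `y n`, the binomial shift `∑ binom(n',n) h^(n'-n) z_{n'}` plus `∑ w(γ,n) z^γ` over the pairs
in `MPlus`. It sends a subcritical `z_(l,k)` to the Taylor expansion `∑ binom(k',k) (y - z)^(k'-k)
z_(l,k')` over subcritical `k'`. Infinitely many `k'` may occur, so the values are power series.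

The identification (`actCoeffPlus_eq`) comes from differential equations in the parameters.
Differentiating in `Z_(γ,n)` gives `z^γ` times the translation of `D^(n) f`. Once the noise
parameters vanish, differentiating in `Zᵢ` gives the translation of `∂ᵢ f`. At zero parameters the
translation is the inclusion. The same recursion governs the action of `DJm` (`rho_insertGen`).
Consequently the matrix of `Gam π` is the transpose of a translation (`Gam_single`), and finiteness
of the coaction says that a translation may be substituted into power series
(`hasSubst_shiftedCoord`).

For the group law, the binomial identity `taylorCoeff_add` shows that substituting one translation
into another gives a map of the same form (`subst_image`), and `subst_shiftedCoord` shows that its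
parameters are again of the admissible kind. This gives `Gam_mul`. Left inverses come from a
triangular system solved by recursion along the homogeneity; a monoid with left inverses is a group.

Triangularity holds because `DJm J m` raises the homogeneity by `∑ (η + |γ| - |n|) + ∑ sᵢ m(i)`,
which is positive unless `(J, m) = 0`, by definition of `MPlus`. Local finiteness rests on writing
`|β| + (η - regsol) [β]` as a sum of weights which are nonnegative on `NMin` (`hom_add_bracket`);
below any level the subcritical weights take finitely many values (`finite_weight_subcritical`). -/

/-- The shifted monomial `∏ (X n + p n) ^ k n`. -/
def shiftPow (p : ι → A) (k : ι →₀ ℕ) : MvPolynomial ι A :=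
  k.prod fun n j => (MvPolynomial.X n + MvPolynomial.C (p n)) ^ j

/-- The coefficient of `X ^ k` in `(X + p) ^ k'`. -/
def taylorCoeff (p : ι → A) (k' k : ι →₀ ℕ) : A := (shiftPow p k').coeff k

theorem shiftPow_zero (k : ι →₀ ℕ) : shiftPow (0 : ι → A) k = MvPolynomial.monomial k 1 := by
  rw [MvPolynomial.monomial_eq]
  simp [shiftPow]

theorem taylorCoeff_zero [DecidableEq ι] (k' k : ι →₀ ℕ) :
    taylorCoeff (0 : ι → A) k' k = if k' = k then 1 else 0 := by
  rw [taylorCoeff, shiftPow_zero, MvPolynomial.coeff_monomial]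

/-- The degree of `(X + p)^k'` in `X n` is at most `k' n`. -/
theorem taylorCoeff_eq_zero (p : ι → A) {k' k : ι →₀ ℕ} (h : ¬ k ≤ k') :
    taylorCoeff p k' k = 0 := by
  classical
  rw [Finsupp.le_def, not_forall] at h
  obtain ⟨n, hn⟩ := h
  by_contra hne
  have h1 : k n ≤ (shiftPow p k').degreeOf n :=
    MvPolynomial.monomial_le_degreeOf n (MvPolynomial.mem_support_iff.2 hne)
  refine hn (h1.trans ?_)
  refine (MvPolynomial.degreeOf_prod_le n _ _).trans ?_
  have hb : ∀ m, (MvPolynomial.X m + MvPolynomial.C (p m) : MvPolynomial ι A).degreeOf n ≤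
      if n = m then 1 else 0 := fun m => by
    refine (MvPolynomial.degreeOf_add_le _ _ _).trans ?_
    rw [MvPolynomial.degreeOf_C, Nat.max_zero]
    nontriviality A
    rw [MvPolynomial.degreeOf_X]
  refine (Finset.sum_le_sum fun m _ => (MvPolynomial.degreeOf_pow_le n _ _).trans
    (Nat.mul_le_mul_left _ (hb m))).trans ?_
  simp only [mul_ite, mul_one, mul_zero, Finset.sum_ite_eq]
  split_ifs <;> omega

theorem map_taylorCoeff {A' : Type*} [CommRing A'] (g : A →+* A') (p : ι → A) (k' k : ι →₀ ℕ) :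
    g (taylorCoeff p k' k) = taylorCoeff (fun n => g (p n)) k' k := by
  rw [taylorCoeff, ← MvPolynomial.coeff_map, taylorCoeff]
  simp [shiftPow, Finsupp.prod, map_prod]

/-- Expand `(X + y)^k'` in powers of `X`, then substitute `X + x` for `X`. This is the identity
behind the composition of translations. -/
theorem taylorCoeff_add (x y : ι → A) (k' k : ι →₀ ℕ) :
    taylorCoeff (x + y) k' k =
      ∑ j ∈ (shiftPow y k').support, taylorCoeff y k' j * taylorCoeff x j k := by
  have h : shiftPow (x + y) k' =
      MvPolynomial.aeval (fun n => MvPolynomial.X n + MvPolynomial.C (x n)) (shiftPow y k') := by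
    simp only [shiftPow, Finsupp.prod, map_prod, map_pow, map_add, MvPolynomial.aeval_X,
      MvPolynomial.aeval_C, MvPolynomial.algebraMap_eq, add_assoc, Pi.add_apply]
  rw [taylorCoeff, h, MvPolynomial.as_sum (shiftPow y k'), map_sum, MvPolynomial.coeff_sum,
    ← MvPolynomial.as_sum]
  refine Finset.sum_congr rfl fun j _ => ?_
  rw [MvPolynomial.aeval_monomial, MvPolynomial.algebraMap_eq, MvPolynomial.coeff_C_mul]
  rfl

/-- Chain rule: applying `δ` to coefficients and `∑ δ(p n) ∂/∂X_n` both obey the Leibniz rule and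
agree on each factor `X n + p n`, hence on `(X + p)^k'`. The factor `k n + 1` comes from reading off
a coefficient of a partial derivative. -/
theorem deriv_taylorCoeff [Algebra ℝ A] (δ : Derivation ℝ A A) (p : ι → A) (F : Finset ι)
    (k' k : ι →₀ ℕ) (hF : ∀ n, k' n ≠ 0 → n ∉ F → δ (p n) = 0) :
    δ (taylorCoeff p k' k) =
      ∑ n ∈ F, δ (p n) * (((k n : ℝ) + 1) • taylorCoeff p k' (k + Finsupp.single n 1)) := by
  classical
  set E : MvPolynomial ι A → MvPolynomial ι A :=
    fun Q => ∑ n ∈ F, MvPolynomial.C (δ (p n)) * MvPolynomial.pderiv n Q with hE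
  have hEmul : ∀ Q Q', E (Q * Q') = E Q * Q' + Q * E Q' := fun Q Q' => by
    simp only [hE, Finset.sum_mul, Finset.mul_sum, ← Finset.sum_add_distrib]
    refine Finset.sum_congr rfl fun n _ => ?_
    rw [MvPolynomial.pderiv_mul]; ring
  have hmul : ∀ Q Q' : MvPolynomial ι A, (∀ k, δ (Q.coeff k) = (E Q).coeff k) →
      (∀ k, δ (Q'.coeff k) = (E Q').coeff k) →
      ∀ k, δ ((Q * Q').coeff k) = (E (Q * Q')).coeff k := fun Q Q' h h' k => by
    rw [hEmul, MvPolynomial.coeff_add, MvPolynomial.coeff_mul, MvPolynomial.coeff_mul,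
      MvPolynomial.coeff_mul, map_sum, ← Finset.sum_add_distrib]
    refine Finset.sum_congr rfl fun x _ => ?_
    rw [Derivation.leibniz, h, h', smul_eq_mul, smul_eq_mul]; ring
  have hone : ∀ k, δ ((1 : MvPolynomial ι A).coeff k) = (E 1).coeff k := fun k => by
    have : E 1 = 0 := by simp [hE]
    rw [this, MvPolynomial.coeff_one]
    split_ifs <;> simp
  have hX : ∀ n, k' n ≠ 0 → ∀ k, δ ((MvPolynomial.X n + MvPolynomial.C (p n)).coeff k) =
      (E (MvPolynomial.X n + MvPolynomial.C (p n))).coeff k := fun n hn k => by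
    have : E (MvPolynomial.X n + MvPolynomial.C (p n)) = MvPolynomial.C (δ (p n)) := by
      simp only [hE, map_add, MvPolynomial.pderiv_C, add_zero, MvPolynomial.pderiv_X,
        Pi.single_apply, mul_ite, mul_one, mul_zero]
      rw [Finset.sum_ite_eq]
      split_ifs with h
      · rfl
      · rw [hF n hn h, map_zero]
    rw [this, MvPolynomial.coeff_add, map_add, MvPolynomial.coeff_X, MvPolynomial.coeff_C,
      MvPolynomial.coeff_C]
    split_ifs <;> simp
  have key : ∀ k, δ ((shiftPow p k').coeff k) = (E (shiftPow p k')).coeff k := by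
    unfold shiftPow Finsupp.prod
    refine Finset.prod_induction _ (fun Q => ∀ k, δ (Q.coeff k) = (E Q).coeff k) hmul hone ?_
    intro n hn
    induction k' n with
    | zero => simpa using hone
    | succ j ih =>
      simp only [pow_succ]
      exact hmul _ _ ih (hX n (Finsupp.mem_support_iff.1 hn))
  rw [taylorCoeff, key, hE, MvPolynomial.coeff_sum]
  refine Finset.sum_congr rfl fun n _ => ?_
  rw [MvPolynomial.coeff_C_mul, MvPolynomial.coeff_pderiv, taylorCoeff, Algebra.smul_def]
  simp [mul_comm]

end Taylor

/-! ### Coefficientwise derivations of power series -/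

section MapDeriv

variable {σ A : Type*} [CommRing A] [Algebra ℝ A]

/-- The derivation of `MvPowerSeries σ A` which applies a derivation of `A` to the coefficients. -/
def mapDeriv (δ : Derivation ℝ A A) :
    Derivation ℝ (MvPowerSeries σ A) (MvPowerSeries σ A) :=
  Derivation.mk'
    { toFun := fun f => fun β => δ (MvPowerSeries.coeff β f)
      map_add' := fun f g => by
        ext β
        change δ _ = δ _ + δ _
        simp
      map_smul' := fun c f => by
        ext β
        change δ (MvPowerSeries.coeff β (c • f)) = c • δ _
        rw [← Derivation.map_smul]; rfl }
    fun f g => by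
      classical
      ext β
      change δ (MvPowerSeries.coeff β (f * g)) = _
      rw [map_add, smul_eq_mul, smul_eq_mul, mul_comm g, MvPowerSeries.coeff_mul,
        MvPowerSeries.coeff_mul, MvPowerSeries.coeff_mul, map_sum, ← Finset.sum_add_distrib]
      refine Finset.sum_congr rfl fun x _ => ?_
      rw [Derivation.leibniz, smul_eq_mul, smul_eq_mul, mul_comm (MvPowerSeries.coeff x.2 g)]
      rfl

theorem coeff_mapDeriv (δ : Derivation ℝ A A) (f : MvPowerSeries σ A) (β : σ →₀ ℕ) :
    MvPowerSeries.coeff β (mapDeriv δ f) = δ (MvPowerSeries.coeff β f) := rfl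

theorem mapDeriv_X (δ : Derivation ℝ A A) (s : σ) :
    mapDeriv δ (MvPowerSeries.X s : MvPowerSeries σ A) = 0 := by
  classical
  ext β
  rw [coeff_mapDeriv, MvPowerSeries.coeff_X]
  split_ifs <;> simp

end MapDeriv

/-! ### Infinite linear combinations of variables -/

section VarSum

variable {σ κ A : Type*} [CommRing A]

/-- The power series `∑ k, c k * X (e k)`. -/
def varSum (e : κ → σ) (c : κ → MvPowerSeries σ A) : MvPowerSeries σ A :=
  fun β => ∑ᶠ k, MvPowerSeries.coeff β (c k * MvPowerSeries.X (e k))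

theorem coeff_mul_X_eq_zero (f : MvPowerSeries σ A) {s : σ} {β : σ →₀ ℕ} (h : β s = 0) :
    MvPowerSeries.coeff β (f * MvPowerSeries.X s) = 0 := by
  classical
  rw [MvPowerSeries.X, MvPowerSeries.coeff_mul_monomial, if_neg]
  rw [Finsupp.single_le_iff, h]; omega

theorem coeff_varSum {e : κ → σ} (c : κ → MvPowerSeries σ A)
    {β : σ →₀ ℕ} {F : Finset κ} (hF : ∀ k, β (e k) ≠ 0 → k ∈ F) :
    MvPowerSeries.coeff β (varSum e c) =
      MvPowerSeries.coeff β (∑ k ∈ F, c k * MvPowerSeries.X (e k)) := by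
  rw [map_sum]
  refine finsum_eq_sum_of_support_subset _ fun k hk => hF k fun h => hk ?_
  exact coeff_mul_X_eq_zero _ h

/-- A fixed coefficient sees only the finitely many variables occurring in `β`, so identities for
`varSum` reduce to finite sums. Uniformity in `β' ≤ β` serves products. -/
theorem exists_finset_varSum {e : κ → σ} (he : Function.Injective e) (β : σ →₀ ℕ) :
    ∃ F : Finset κ, ∀ β' ≤ β, ∀ k, β' (e k) ≠ 0 → k ∈ F := by
  classical
  refine ⟨β.support.preimage e he.injOn, fun β' h k hk => ?_⟩
  rw [Finset.mem_preimage, Finsupp.mem_support_iff]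
  have := h (e k)
  omega

theorem mul_varSum {e : κ → σ} (he : Function.Injective e) (f : MvPowerSeries σ A)
    (c : κ → MvPowerSeries σ A) : f * varSum e c = varSum e fun k => f * c k := by
  classical
  ext β
  obtain ⟨F, hF⟩ := exists_finset_varSum he β
  rw [coeff_varSum _ (hF β le_rfl), MvPowerSeries.coeff_mul]
  simp only [mul_assoc, ← Finset.mul_sum]
  rw [MvPowerSeries.coeff_mul]
  refine Finset.sum_congr rfl fun x hx => ?_
  rw [coeff_varSum _ (hF x.2 (Finset.HasAntidiagonal.mem_antidiagonal.1 hx ▸ le_add_self))]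

theorem varSum_add {e : κ → σ} (he : Function.Injective e) (c c' : κ → MvPowerSeries σ A) :
    varSum e (fun k => c k + c' k) = varSum e c + varSum e c' := by
  ext β
  obtain ⟨F, hF⟩ := exists_finset_varSum he β
  have hF := hF β le_rfl
  rw [map_add, coeff_varSum _ hF, coeff_varSum _ hF, coeff_varSum _ hF, ← map_add,
    ← Finset.sum_add_distrib]
  simp only [add_mul]

theorem varSum_zero (e : κ → σ) : varSum e (fun _ => (0 : MvPowerSeries σ A)) = 0 := by
  ext β
  change ∑ᶠ k, MvPowerSeries.coeff β (0 * MvPowerSeries.X (e k)) = 0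
  simp

theorem varSum_sum {e : κ → σ} (he : Function.Injective e) {τ : Type*} (F : Finset τ)
    (c : τ → κ → MvPowerSeries σ A) :
    varSum e (fun k => ∑ t ∈ F, c t k) = ∑ t ∈ F, varSum e (c t) := by
  classical
  induction F using Finset.induction_on with
  | empty => simpa using varSum_zero e
  | insert t F ht ih =>
    simp only [Finset.sum_insert ht]
    rw [varSum_add he, ih]

theorem mapDeriv_varSum [Algebra ℝ A] {e : κ → σ} (he : Function.Injective e)
    (δ : Derivation ℝ A A) (c : κ → MvPowerSeries σ A) :
    mapDeriv δ (varSum e c) = varSum e fun k => mapDeriv δ (c k) := by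
  ext β
  obtain ⟨F, hF⟩ := exists_finset_varSum he β
  have hF := hF β le_rfl
  rw [coeff_mapDeriv, coeff_varSum _ hF, coeff_varSum _ hF, ← coeff_mapDeriv, map_sum]
  congr 1
  refine Finset.sum_congr rfl fun k _ => ?_
  rw [Derivation.leibniz, mapDeriv_X, smul_zero, zero_add, smul_eq_mul, mul_comm]

theorem map_varSum {A' : Type*} [CommRing A'] {e : κ → σ} (he : Function.Injective e)
    (g : A →+* A') (c : κ → MvPowerSeries σ A) :
    MvPowerSeries.map g (varSum e c) = varSum e fun k => MvPowerSeries.map g (c k) := by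
  ext β
  obtain ⟨F, hF⟩ := exists_finset_varSum he β
  have hF := hF β le_rfl
  rw [MvPowerSeries.coeff_map, coeff_varSum _ hF, coeff_varSum _ hF, ← MvPowerSeries.coeff_map]
  simp

theorem varSum_ite [DecidableEq κ] {e : κ → σ} (k : κ) (f : MvPowerSeries σ A) :
    varSum e (fun j => if j = k then f else 0) = f * MvPowerSeries.X (e k) := by
  ext β
  change ∑ᶠ j, MvPowerSeries.coeff β ((if j = k then f else 0) * MvPowerSeries.X (e j)) = _
  rw [finsum_eq_single _ k fun j hj => by simp [hj], if_pos rfl]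

end VarSum

/-- Both sides are derivations along `C`, so the variables decide. -/
theorem AlgHom.deriv_comp_eq {A : Type*} [CommRing A] [Algebra ℝ A] {σ : Type*}
    (C : MvPolynomial σ ℝ →ₐ[ℝ] A) (δ : Derivation ℝ A A) (u : A)
    (E : Derivation ℝ (MvPolynomial σ ℝ) (MvPolynomial σ ℝ))
    (h : ∀ x, δ (C (MvPolynomial.X x)) = u * C (E (MvPolynomial.X x))) (f : MvPolynomial σ ℝ) :
    δ (C f) = u * C (E f) := by
  induction f using MvPolynomial.induction_on with
  | C a => simp [← MvPolynomial.algebraMap_eq]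
  | add p q hp hq => rw [map_add, map_add, map_add, map_add, mul_add, hp, hq]
  | mul_X p x hp =>
    rw [map_mul, Derivation.leibniz, Derivation.leibniz, hp, h, map_add, smul_eq_mul, smul_eq_mul,
      smul_eq_mul, smul_eq_mul, map_mul, map_mul]
    ring

namespace Setting

variable (S : Setting d Λ)

/-! ### Elementary facts on degrees and subcriticality -/

theorem le_deg (n : Fin d → ℕ) (i : Fin d) : (n i : ℝ) ≤ S.deg n := by
  have h0 : ∀ j ∈ Finset.univ, 0 ≤ S.s j * (n j : ℝ) :=
    fun j _ => mul_nonneg (zero_le_one.trans (S.one_le_s j)) (Nat.cast_nonneg _)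
  refine le_trans ?_ (Finset.single_le_sum h0 (Finset.mem_univ i))
  nlinarith [S.one_le_s i, (Nat.cast_nonneg (n i) : (0 : ℝ) ≤ n i)]

theorem deg_nonneg (n : Fin d → ℕ) : 0 ≤ S.deg n :=
  Finset.sum_nonneg fun j _ => mul_nonneg (zero_le_one.trans (S.one_le_s j)) (Nat.cast_nonneg _)

theorem deg_mono {n n' : Fin d → ℕ} (h : n ≤ n') : S.deg n ≤ S.deg n' :=
  Finset.sum_le_sum fun j _ =>
    mul_le_mul_of_nonneg_left (Nat.cast_le.2 (h j)) (zero_le_one.trans (S.one_le_s j))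

theorem deg_add_single (n : Fin d → ℕ) (i : Fin d) :
    S.deg (n + Pi.single i 1) = S.deg n + S.s i := by
  classical
  simp [deg, mul_add, Finset.sum_add_distrib, Pi.single_apply]

theorem finite_deg_le (c : ℝ) : {n : Fin d → ℕ | S.deg n ≤ c}.Finite := by
  refine (Set.Finite.pi' fun _ : Fin d => Set.finite_Iic ⌊c⌋₊).subset fun n hn i => ?_
  exact Nat.le_floor ((S.le_deg n i).trans hn)

variable {S}

theorem Subcritical.mono {l : Option Λ} {k k' : MI (Fin d → ℕ)} (h : S.Subcritical l k')
    (hk : k ≤ k') : S.Subcritical l k :=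
  ⟨h.1, fun j hj hjk => h.2 j hj (hjk.trans hk)⟩

theorem Subcritical.deg_lt {l : Option Λ} {k : MI (Fin d → ℕ)} (h : S.Subcritical l k)
    {n : Fin d → ℕ} (hn : k n ≠ 0) : S.deg n < S.η := by
  have := (h.2 (Finsupp.single n 1) (by simp)
    (by rw [Finsupp.single_le_iff]; omega)).1
  rw [Finsupp.sum_single_index (by simp)] at this
  push_cast at this
  linarith

variable (S)

theorem D_X_inr [DecidableEq (Fin d → ℕ)] (n m : Fin d → ℕ) :
    S.D n (MvPolynomial.X (Sum.inr m)) = if m = n then 1 else 0 := by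
  rw [D, MvPolynomial.mkDerivation_X, Sum.elim_inr]
  congr

open Classical in
theorem D_X_inl (n : Fin d → ℕ) (l : Option Λ) (k : MI (Fin d → ℕ)) :
    S.D n (MvPolynomial.X (Sum.inl (l, k))) =
      if S.Subcritical l (k + Finsupp.single n 1) then
      ((k n : ℝ) + 1) • MvPolynomial.X (Sum.inl (l, k + Finsupp.single n 1)) else 0 := by
  rw [D, MvPolynomial.mkDerivation_X, Sum.elim_inl]

theorem dx_X_inr (i : Fin d) (m : Fin d → ℕ) :
    S.dx i (MvPolynomial.X (Sum.inr m)) =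
      ((m i : ℝ) + 1) • MvPolynomial.X (Sum.inr (m + Pi.single i 1)) := by
  classical
  rw [dx, MvPolynomial.mkDerivation_X, finsum_eq_single _ m]
  · rw [D_X_inr, if_pos rfl, mul_one]
  · intro n hn
    rw [D_X_inr, if_neg hn.symm, mul_zero, smul_zero]

theorem dx_X_inl (i : Fin d) (l : Option Λ) (k : MI (Fin d → ℕ)) {F : Finset (Fin d → ℕ)}
    (hF : ∀ n, S.deg n < S.η → n ∈ F) :
    S.dx i (MvPolynomial.X (Sum.inl (l, k))) = ∑ n ∈ F,
      ((n i : ℝ) + 1) • (MvPolynomial.X (Sum.inr (n + Pi.single i 1)) *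
        S.D n (MvPolynomial.X (Sum.inl (l, k)))) := by
  classical
  rw [dx, MvPolynomial.mkDerivation_X]
  refine finsum_eq_sum_of_support_subset _ fun n hn => hF n ?_
  by_contra h
  refine hn ?_
  dsimp only
  rw [D_X_inl, if_neg, mul_zero, smul_zero]
  exact fun hs => h (hs.deg_lt (n := n) (by simp))

/-! ### The translation homomorphism -/

section Translation

variable {K : Type*} [CommRing K]

open Classical in
/-- The images of the coordinates under the translation which maps `z_n` to `y n`. -/
def image (y : (Fin d → ℕ) → MvPowerSeries (Coord d Λ) K) : Coord d Λ →
    MvPowerSeries (Coord d Λ) K :=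
  Sum.elim
    (fun lk => if S.Subcritical lk.1 lk.2 then
      varSum (fun k => Sum.inl (lk.1, k)) fun k => if S.Subcritical lk.1 k then
        taylorCoeff (fun n => y n - MvPowerSeries.X (Sum.inr n)) k lk.2 else 0
      else MvPowerSeries.X (Sum.inl lk))
    y

/-- The algebra morphism with `z_n ↦ y n` which shifts the nonlinearities accordingly. -/
def transl [Algebra ℝ K] (y : (Fin d → ℕ) → MvPowerSeries (Coord d Λ) K) :
    Poly d Λ →ₐ[ℝ] MvPowerSeries (Coord d Λ) K :=
  MvPolynomial.aeval (S.image y)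

theorem inl_injective (l : Option Λ) :
    Function.Injective fun k : MI (Fin d → ℕ) => (Sum.inl (l, k) : Coord d Λ) :=
  fun _ _ h => (Prod.ext_iff.1 (Sum.inl_injective h)).2

open Classical in
theorem image_inl_of_subcritical (y : (Fin d → ℕ) → MvPowerSeries (Coord d Λ) K) {l : Option Λ}
    {k : MI (Fin d → ℕ)} (h : S.Subcritical l k) :
    S.image y (Sum.inl (l, k)) = varSum (fun k => Sum.inl (l, k)) fun k' =>
      if S.Subcritical l k' then
        taylorCoeff (fun n => y n - MvPowerSeries.X (Sum.inr n)) k' k else 0 := by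
  rw [image, Sum.elim_inl, if_pos h]

theorem image_inl_of_not (y : (Fin d → ℕ) → MvPowerSeries (Coord d Λ) K) {l : Option Λ}
    {k : MI (Fin d → ℕ)} (h : ¬ S.Subcritical l k) :
    S.image y (Sum.inl (l, k)) = MvPowerSeries.X (Sum.inl (l, k)) := by
  rw [image, Sum.elim_inl, if_neg h]

open Classical in
/-- The defining formula for the image of `z_(l,k)` holds up to the subcriticality of `(l,k)`. -/
theorem ite_image_inl (y : (Fin d → ℕ) → MvPowerSeries (Coord d Λ) K) (l : Option Λ)
    (k : MI (Fin d → ℕ)) :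
    (if S.Subcritical l k then S.image y (Sum.inl (l, k)) else 0) =
      varSum (fun k => Sum.inl (l, k)) fun k' =>
      if S.Subcritical l k' then
        taylorCoeff (fun n => y n - MvPowerSeries.X (Sum.inr n)) k' k else 0 := by
  split_ifs with h
  · rw [image_inl_of_subcritical S y h]
  · refine (varSum_zero fun k => Sum.inl (l, k)).symm.trans ?_
    congr 1
    ext1 k'
    split_ifs with h'
    · rw [taylorCoeff_eq_zero _ fun hk => h (h'.mono hk)]
    · rfl

theorem transl_X [Algebra ℝ K] (y : (Fin d → ℕ) → MvPowerSeries (Coord d Λ) K) (x : Coord d Λ) :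
    S.transl y (MvPolynomial.X x) = S.image y x := MvPolynomial.aeval_X _ _

/-- Chain rule for the Taylor expansion in `y n - z_n`: differentiation raises `k` by `e_n`, as
`D^(n)` does. Only `|n| < η` matters, since a subcritical `k'` contains no other `n`. The cutoffs
match because subcriticality is inherited by smaller `k`; a non-subcritical `z_(l,k)` is fixed by
the translation and killed by every `D^(n)`. -/
theorem mapDeriv_image_inl [Algebra ℝ K] (y : (Fin d → ℕ) → MvPowerSeries (Coord d Λ) K)
    (δ : Derivation ℝ K K) {F : Finset (Fin d → ℕ)}
    (hF : ∀ n, S.deg n < S.η → n ∉ F → mapDeriv δ (y n) = 0) (l : Option Λ)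
    (k : MI (Fin d → ℕ)) :
    mapDeriv δ (S.image y (Sum.inl (l, k))) =
      ∑ n ∈ F, mapDeriv δ (y n) * S.transl y (S.D n (MvPolynomial.X (Sum.inl (l, k)))) := by
  classical
  have hD : ∀ n, S.transl y (S.D n (MvPolynomial.X (Sum.inl (l, k)))) =
      varSum (fun k => Sum.inl (l, k)) fun k' => ((k n : ℝ) + 1) • if S.Subcritical l k' then
        taylorCoeff (fun n => y n - MvPowerSeries.X (Sum.inr n)) k' (k + Finsupp.single n 1)
        else 0 := fun n => by
    have := congrArg (fun f => algebraMap ℝ (MvPowerSeries (Coord d Λ) K) ((k n : ℝ) + 1) * f)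
      (S.ite_image_inl y l (k + Finsupp.single n 1))
    simp only [mul_varSum (inl_injective l), ← Algebra.smul_def] at this
    rw [← this, D_X_inl]
    split_ifs
    · rw [map_smul, transl_X]
    · rw [map_zero, smul_zero]
  by_cases h : S.Subcritical l k
  · rw [image_inl_of_subcritical S y h, mapDeriv_varSum (inl_injective l)]
    simp only [hD, mul_varSum (inl_injective l)]
    rw [← varSum_sum (inl_injective l)]
    congr 1
    ext1 k'
    split_ifs with hk'
    · rw [deriv_taylorCoeff (mapDeriv δ) _ F]
      · simp only [map_sub, mapDeriv_X, sub_zero]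
      · intro n hn hnF
        rw [map_sub, mapDeriv_X, sub_zero]
        exact hF n (hk'.deg_lt hn) hnF
    · simp
  · rw [image_inl_of_not S y h, mapDeriv_X]
    refine (Finset.sum_eq_zero fun n _ => ?_).symm
    rw [D_X_inl, if_neg (fun h' => h (h'.mono le_self_add)), map_zero, mul_zero]

theorem map_image {K' : Type*} [CommRing K'] (g : K →+* K')
    (y : (Fin d → ℕ) → MvPowerSeries (Coord d Λ) K) (x : Coord d Λ) :
    MvPowerSeries.map g (S.image y x) = S.image (fun n => MvPowerSeries.map g (y n)) x := by
  classical
  rcases x with ⟨l, k⟩ | n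
  · by_cases h : S.Subcritical l k
    · rw [image_inl_of_subcritical S _ h, image_inl_of_subcritical S _ h,
        map_varSum (inl_injective l)]
      congr 1
      ext1 k'
      split_ifs
      · rw [map_taylorCoeff]
        simp
      · simp
    · rw [image_inl_of_not S _ h, image_inl_of_not S _ h, MvPowerSeries.map_X]
  · rfl

/-- Translations are natural in the coefficient ring. This specialises the universal one to a
character, to zero parameters, or to vanishing noise parameters. -/
theorem map_transl [Algebra ℝ K] {K' : Type*} [CommRing K'] [Algebra ℝ K'] (g : K →ₐ[ℝ] K')
    (y : (Fin d → ℕ) → MvPowerSeries (Coord d Λ) K) (f : Poly d Λ) :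
    MvPowerSeries.map (g : K →+* K') (S.transl y f) =
      S.transl (fun n => MvPowerSeries.map (g : K →+* K') (y n)) f := by
  induction f using MvPolynomial.induction_on with
  | C a =>
    rw [← MvPolynomial.algebraMap_eq, AlgHom.commutes, AlgHom.commutes,
      MvPowerSeries.algebraMap_apply, MvPowerSeries.algebraMap_apply, MvPowerSeries.map_C]
    simp
  | add p q hp hq => rw [map_add, map_add, map_add, hp, hq]
  | mul_X p x hp => rw [map_mul, map_mul, map_mul, hp, transl_X, transl_X, map_image]

theorem image_X : S.image (fun n => (MvPowerSeries.X (Sum.inr n) : MvPowerSeries (Coord d Λ) K)) =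
    MvPowerSeries.X := by
  classical
  ext1 x
  rcases x with ⟨l, k⟩ | n
  · by_cases h : S.Subcritical l k
    · rw [image_inl_of_subcritical S _ h]
      have : (fun k' => if S.Subcritical l k' then taylorCoeff (fun n : Fin d → ℕ =>
          (MvPowerSeries.X (Sum.inr n) : MvPowerSeries (Coord d Λ) K) -
            MvPowerSeries.X (Sum.inr n)) k' k else 0) = fun k' => if k' = k then 1 else 0 := by
        ext1 k'
        have h0 : (fun n : Fin d → ℕ => (MvPowerSeries.X (Sum.inr n) :
          MvPowerSeries (Coord d Λ) K) - MvPowerSeries.X (Sum.inr n)) = 0 := by ext1; simp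
        rw [h0, taylorCoeff_zero]
        by_cases hk : k' = k
        · subst hk; simp [h]
        · simp [hk]
      rw [this, varSum_ite, one_mul]
    · rw [image_inl_of_not S _ h]
  · rfl

theorem coeff_transl_X [Algebra ℝ K] (f : Poly d Λ) (β : MI (Coord d Λ)) :
    MvPowerSeries.coeff β (S.transl
      (fun n => (MvPowerSeries.X (Sum.inr n) : MvPowerSeries (Coord d Λ) K)) f) =
      algebraMap ℝ K (f.coeff β) := by
  have : S.transl (fun n => (MvPowerSeries.X (Sum.inr n) : MvPowerSeries (Coord d Λ) K)) f =
      (MvPolynomial.map (algebraMap ℝ K) f : MvPolynomial (Coord d Λ) K) := by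
    rw [transl, image_X]
    induction f using MvPolynomial.induction_on with
    | C a => simp [MvPowerSeries.algebraMap_apply]
    | add p q hp hq => rw [map_add, map_add, hp, hq, MvPolynomial.coe_add]
    | mul_X p x hp => rw [map_mul, map_mul, hp, MvPolynomial.coe_mul]; simp
  rw [this, MvPolynomial.coeff_coe, MvPolynomial.coeff_map]

/-- The image of a subcritical `z_(l,k)` contributes at `β` only if `β` contains some `(l,k')` and
`X^k` occurs in the polynomial `(X + y - z)^k'`. This leaves finitely many `(l,k)`, and `hfin`
treats the `z_n`. -/
theorem hasSubst_image {y : (Fin d → ℕ) → MvPowerSeries (Coord d Λ) K}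
    (h0 : ∀ n, MvPowerSeries.constantCoeff (y n) = 0)
    (hfin : ∀ β, {n | MvPowerSeries.coeff β (y n) ≠ 0}.Finite) :
    MvPowerSeries.HasSubst (S.image y) := by
  classical
  have hmem : ∀ (β : MI (Coord d Λ)) l k, MvPowerSeries.coeff β (S.image y (Sum.inl (l, k))) ≠ 0 →
      β (Sum.inl (l, k)) ≠ 0 ∨ ∃ k', β (Sum.inl (l, k')) ≠ 0 ∧
        k ∈ (shiftPow (fun n => y n - MvPowerSeries.X (Sum.inr n)) k').support := fun β l k h => by
    by_cases hs : S.Subcritical l k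
    · rw [image_inl_of_subcritical S y hs] at h
      obtain ⟨k', hk'⟩ := not_forall.1 fun h' => h (finsum_eq_zero_of_forall_eq_zero h')
      refine Or.inr ⟨k', fun h' => hk' (coeff_mul_X_eq_zero _ h'), ?_⟩
      rw [MvPolynomial.mem_support_iff]
      intro h'
      refine hk' ?_
      simp only [taylorCoeff, h', ite_self, zero_mul, map_zero]
    · rw [image_inl_of_not S y hs, MvPowerSeries.coeff_X] at h
      refine Or.inl fun h' => h ?_
      rw [if_neg]
      rintro rfl
      simp at h'
  refine ⟨fun x => ?_, fun β => ?_⟩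
  · have : MvPowerSeries.constantCoeff (S.image y x) = 0 := by
      rcases x with ⟨l, k⟩ | n
      · by_contra h
        rw [← MvPowerSeries.coeff_zero_eq_constantCoeff_apply] at h
        rcases hmem 0 l k h with h' | ⟨k', h', -⟩ <;> exact h' rfl
      · exact h0 n
    rw [this]
    exact IsNilpotent.zero
  · refine (((hfin β).image Sum.inr).union ((β.support.finite_toSet).union
      (Set.Finite.biUnion β.support.finite_toSet fun x _ => Set.Finite.image Sum.inl
        ((Set.finite_singleton (x.elim Prod.fst fun _ => none)).prod
          (shiftPow (fun n => y n - MvPowerSeries.X (Sum.inr n))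
            (x.elim Prod.snd fun _ => 0)).support.finite_toSet)))).subset ?_
    rintro (⟨l, k⟩ | n) hx
    · rcases hmem β l k hx with h' | ⟨k', h', hk⟩
      · exact Or.inr (Or.inl (by simpa using h'))
      · refine Or.inr (Or.inr ?_)
        refine Set.mem_biUnion (x := Sum.inl (l, k')) (by simpa using h') ?_
        exact ⟨(l, k), ⟨rfl, hk⟩, rfl⟩
    · exact Or.inl ⟨n, hx, rfl⟩

end Translation

end Setting

/-! ### Induction in enveloping algebras and bookkeeping for multi-indices -/

/-- The elements whose left multiplication preserves `P` form a subalgebra containing `L`. By the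
universal property the identity factors through it. -/
theorem UniversalEnvelopingAlgebra.induction_mul {L : Type*} [LieRing L] [LieAlgebra ℝ L]
    {P : UniversalEnvelopingAlgebra ℝ L → Prop}
    (one : P 1) (smul : ∀ (c : ℝ) U, P U → P (c • U)) (add : ∀ U V, P U → P V → P (U + V))
    (mul : ∀ (E : L) U, P U → P (UniversalEnvelopingAlgebra.ι ℝ E * U))
    (U : UniversalEnvelopingAlgebra ℝ L) : P U := by
  let A : Subalgebra ℝ (UniversalEnvelopingAlgebra ℝ L) :=
    { carrier := {U | ∀ V, P V → P (U * V)}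
      mul_mem' := fun {a b} ha hb V hV => by rw [mul_assoc]; exact ha _ (hb _ hV)
      add_mem' := fun {a b} ha hb V hV => by rw [add_mul]; exact add _ _ (ha _ hV) (hb _ hV)
      algebraMap_mem' := fun c V hV => by rw [← Algebra.smul_def]; exact smul _ _ hV }
  let g : UniversalEnvelopingAlgebra ℝ L →ₐ[ℝ] A := UniversalEnvelopingAlgebra.lift ℝ
    { toFun := fun E => ⟨UniversalEnvelopingAlgebra.ι ℝ E, fun V hV => mul E V hV⟩
      map_add' := fun E F => Subtype.ext (by simp)
      map_smul' := fun c E => Subtype.ext (by simp)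
      map_lie' := fun {E F} => Subtype.ext (by
        simp [LieRing.of_associative_ring_bracket]) }
  have hg : A.val.comp g = AlgHom.id ℝ _ := by
    apply UniversalEnvelopingAlgebra.hom_ext
    ext E
    simp [g]
  have hU : U ∈ A := by
    have := DFunLike.congr_fun hg U
    rw [AlgHom.id_apply] at this
    rw [← this]
    exact (g U).2
  simpa using hU 1 one

theorem prod_factorial_add_single {I : Type*} (K : I →₀ ℕ) (x : I) :
    ((K + Finsupp.single x 1).prod fun _ j => j !) = (K x + 1) * K.prod fun _ j => j ! := by
  classical
  rw [Finsupp.prod_of_support_subset (s := insert x K.support), Finsupp.prod_of_support_subset K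
    (s := insert x K.support) (Finset.subset_insert _ _), ← Finset.mul_prod_erase _ _
    (Finset.mem_insert_self x K.support), ← Finset.mul_prod_erase (insert x K.support) (fun i => (K i)!)
    (Finset.mem_insert_self x K.support), ← mul_assoc]
  · congr 1
    · simp [Nat.factorial_succ]
    · refine Finset.prod_congr rfl fun i hi => ?_
      have : x ≠ i := (Finset.ne_of_mem_erase hi).symm
      simp [this]
  · simp
  · intro i hi
    rw [Finsupp.mem_support_iff, Finsupp.add_apply, Finsupp.single_apply] at hi
    rw [Finset.mem_insert, Finsupp.mem_support_iff]
    by_contra h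
    push Not at h
    rw [if_neg (Ne.symm h.1), h.2] at hi
    exact hi rfl
  · simp

/-- Functions on `Fin d` as finitely supported functions. -/
abbrev toMI (n : Fin d → ℕ) : MI (Fin d) := Finsupp.equivFunOnFinite.symm n

theorem toMI_add_single (n : Fin d → ℕ) (i : Fin d) :
    toMI (n + Pi.single i 1) = toMI n + Finsupp.single i 1 := by
  classical
  ext j
  simp [Pi.single_apply, Finsupp.single_apply, eq_comm]

theorem inr_single_injective :
    Function.Injective fun n : Fin d → ℕ => (Finsupp.single (Sum.inr n) 1 : MI (Coord d Λ)) := by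
  intro n n' h
  exact Sum.inr_injective (Finsupp.single_left_injective one_ne_zero h)

namespace Setting

variable (S : Setting d Λ)

theorem single_inr_notMem_N (n : Fin d → ℕ) :
    (Finsupp.single (Sum.inr n) 1 : MI (Coord d Λ)) ∉ S.N := fun h => by
  have := h.2
  rw [noiseHom_inr] at this
  exact lt_irrefl _ this

/-! ### The action of the basis elements -/

theorem rho_ι (E : S.L) (f : Poly d Λ) :
    S.rho (UniversalEnvelopingAlgebra.ι ℝ E) f = (E : Derivation ℝ (Poly d Λ) (Poly d Λ)) f := by
  rw [rho, UniversalEnvelopingAlgebra.lift_ι_apply]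
  rfl

/-- In the inductive step, the correction `-(E f) U D^(n)` cancels the term of the Leibniz rule in
which `E` hits `f`. -/
theorem rho_insertD (n : Fin d → ℕ) (U : S.UL) (f : S.TN) (g : Poly d Λ) :
    S.rho (S.insertD n U f) g = f * S.rho U (S.D n g) := by
  induction U using UniversalEnvelopingAlgebra.induction_mul generalizing f g with
  | one =>
    rw [insertD_one, smulD, LinearMap.comp_apply]
    refine (S.rho_ι _ g).trans ?_
    simp
  | smul c U h =>
    have : S.insertD n (c • U) f = c • S.insertD n U f := by simp [insertD]
    rw [this, map_smul, map_smul, LinearMap.smul_apply, LinearMap.smul_apply, h, mul_smul_comm]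
  | add U V hU hV =>
    have : S.insertD n (U + V) f = S.insertD n U f + S.insertD n V f := by simp [insertD]
    rw [this, map_add, map_add, LinearMap.add_apply, LinearMap.add_apply, hU, hV, mul_add]
  | mul E U h =>
    rw [insertD_ι_mul, map_sub, LinearMap.sub_apply, map_mul, map_mul, Module.End.mul_apply,
      Module.End.mul_apply, h, h, rho_ι, rho_ι, Derivation.leibniz, actTN]
    simp only [smul_eq_mul, LinearMap.coe_restrict_apply, Derivation.coeFn_coe]
    ring

theorem rho_insertGen (p : S.M) (U : S.UL) (g : Poly d Λ) :
    S.rho (S.insertGen p U) g = MvPolynomial.monomial p.1.1 1 * S.rho U (S.D p.2 g) :=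
  S.rho_insertD _ _ _ _

theorem dxPow_eq_list_prod (m : Fin d → ℕ) : ∃ L : List (Fin d),
    S.dxPow m = (L.map fun i => (UniversalEnvelopingAlgebra.ι ℝ (S.dxL i) : S.UL)).prod ∧
    (L.map fun i => (Finsupp.single i 1 : MI (Fin d))).sum = toMI m := by
  classical
  refine ⟨(List.ofFn fun i => List.replicate (m i) i).flatten, ?_, ?_⟩
  · rw [List.map_flatten, List.prod_flatten, List.map_ofFn, List.map_ofFn, dxPow]
    congr 2
    ext1 i
    simp
  · rw [List.map_flatten, List.sum_flatten, List.map_ofFn, List.map_ofFn, List.sum_ofFn]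
    ext j
    simp [Finsupp.single_apply]

/-! ### The coordinates of a translation -/

section Coordinates

variable {K : Type*} [CommRing K]

/-- The image of `z_n` under the shift by `h`. -/
def polyCoord (Λ : Type*) (h : Fin d → K) (n : Fin d → ℕ) : MvPowerSeries (Coord d Λ) K :=
  Function.extend (fun n' : Fin d → ℕ => (Finsupp.single (Sum.inr n') 1 : MI (Coord d Λ)))
    (fun n' => taylorCoeff h (toMI n') (toMI n)) 0

theorem coeff_polyCoord_single (h : Fin d → K) (n n' : Fin d → ℕ) :
    MvPowerSeries.coeff (Finsupp.single (Sum.inr n') 1) (polyCoord Λ h n) =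
      taylorCoeff h (toMI n') (toMI n) := by
  change polyCoord Λ h n (Finsupp.single (Sum.inr n') 1) = _
  exact inr_single_injective.extend_apply _ _ _

theorem coeff_polyCoord_of_notMem (h : Fin d → K) (n : Fin d → ℕ) {β : MI (Coord d Λ)}
    (hβ : β ∉ P d Λ) : MvPowerSeries.coeff β (polyCoord Λ h n) = 0 := by
  change polyCoord Λ h n β = 0
  exact Function.extend_apply' _ _ _ hβ

open Classical in
/-- The power series `∑ w(γ,n) z^γ` over all `γ` with `(γ,n) ∈ M⁺`. -/
def noisePart (w : S.MPlus → K) (n : Fin d → ℕ) : MvPowerSeries (Coord d Λ) K := fun β =>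
  if h : ∃ _ : β ∈ S.N, S.deg n < S.η + S.hom β then w ⟨(⟨β, h.1⟩, n), h.2⟩ else 0

theorem coeff_noisePart (w : S.MPlus → K) (n : Fin d → ℕ) {β : MI (Coord d Λ)} (hβ : β ∈ S.N)
    (h : S.deg n < S.η + S.hom β) :
    MvPowerSeries.coeff β (S.noisePart w n) = w ⟨(⟨β, hβ⟩, n), h⟩ :=
  dif_pos ⟨hβ, h⟩

theorem coeff_noisePart_of_not (w : S.MPlus → K) (n : Fin d → ℕ) {β : MI (Coord d Λ)}
    (h : ¬ (β ∈ S.N ∧ S.deg n < S.η + S.hom β)) :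
    MvPowerSeries.coeff β (S.noisePart w n) = 0 :=
  dif_neg fun ⟨h1, h2⟩ => h ⟨h1, h2⟩

/-- The image of `z_n` under the translation with parameters `w`. -/
def shiftedCoord (w : S.MPlus ⊕ Fin d → K) (n : Fin d → ℕ) : MvPowerSeries (Coord d Λ) K :=
  polyCoord Λ (fun i => w (Sum.inr i)) n + S.noisePart (fun x => w (Sum.inl x)) n

theorem coeff_shiftedCoord_single (w : S.MPlus ⊕ Fin d → K) (n n' : Fin d → ℕ) :
    MvPowerSeries.coeff (Finsupp.single (Sum.inr n') 1) (S.shiftedCoord w n) =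
      taylorCoeff (fun i => w (Sum.inr i)) (toMI n') (toMI n) := by
  rw [shiftedCoord, map_add, coeff_polyCoord_single,
    coeff_noisePart_of_not S _ _ fun h => S.single_inr_notMem_N _ h.1, add_zero]

theorem notMem_P_of_mem_N {β : MI (Coord d Λ)} (hβ : β ∈ S.N) : β ∉ P d Λ := by
  rintro ⟨n, rfl⟩
  exact S.single_inr_notMem_N n hβ

theorem coeff_shiftedCoord (w : S.MPlus ⊕ Fin d → K) (n : Fin d → ℕ) {β : MI (Coord d Λ)}
    (hβ : β ∈ S.N) (h : S.deg n < S.η + S.hom β) :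
    MvPowerSeries.coeff β (S.shiftedCoord w n) = w (Sum.inl ⟨(⟨β, hβ⟩, n), h⟩) := by
  rw [shiftedCoord, map_add, coeff_polyCoord_of_notMem _ _ (S.notMem_P_of_mem_N hβ), zero_add,
    coeff_noisePart]

theorem coeff_shiftedCoord_of_not (w : S.MPlus ⊕ Fin d → K) (n : Fin d → ℕ)
    {β : MI (Coord d Λ)} (hβ : β ∉ P d Λ) (h : ¬ (β ∈ S.N ∧ S.deg n < S.η + S.hom β)) :
    MvPowerSeries.coeff β (S.shiftedCoord w n) = 0 := by
  rw [shiftedCoord, map_add, coeff_polyCoord_of_notMem _ _ hβ, zero_add,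
    coeff_noisePart_of_not S _ _ h]

/-- Power series are determined by their coefficients at the three kinds of multi-indices. -/
theorem shiftedCoord_eq {w : S.MPlus ⊕ Fin d → K} {n : Fin d → ℕ}
    {f : MvPowerSeries (Coord d Λ) K}
    (h1 : ∀ n', MvPowerSeries.coeff (Finsupp.single (Sum.inr n') 1) f =
      taylorCoeff (fun i => w (Sum.inr i)) (toMI n') (toMI n))
    (h2 : ∀ β (hβ : β ∈ S.N) (h : S.deg n < S.η + S.hom β),
      MvPowerSeries.coeff β f = w (Sum.inl ⟨(⟨β, hβ⟩, n), h⟩))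
    (h3 : ∀ β, β ∉ P d Λ → ¬ (β ∈ S.N ∧ S.deg n < S.η + S.hom β) →
      MvPowerSeries.coeff β f = 0) : f = S.shiftedCoord w n := by
  ext β
  by_cases hP : β ∈ P d Λ
  · obtain ⟨n', rfl⟩ := hP
    rw [h1, coeff_shiftedCoord_single]
  · by_cases h : β ∈ S.N ∧ S.deg n < S.η + S.hom β
    · rw [h2 β h.1 h.2, coeff_shiftedCoord]
    · rw [h3 β hP h, coeff_shiftedCoord_of_not S _ _ hP h]

theorem map_shiftedCoord {K' : Type*} [CommRing K'] (g : K →+* K') (w : S.MPlus ⊕ Fin d → K)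
    (n : Fin d → ℕ) : MvPowerSeries.map g (S.shiftedCoord w n) =
      S.shiftedCoord (fun x => g (w x)) n := by
  refine S.shiftedCoord_eq (fun n' => ?_) (fun β hβ h => ?_) fun β hβ h => ?_
  · rw [MvPowerSeries.coeff_map, coeff_shiftedCoord_single, map_taylorCoeff]
  · rw [MvPowerSeries.coeff_map, coeff_shiftedCoord S w n hβ h]
  · rw [MvPowerSeries.coeff_map, coeff_shiftedCoord_of_not S _ _ hβ h, map_zero]

theorem shiftedCoord_zero (n : Fin d → ℕ) :
    S.shiftedCoord (0 : S.MPlus ⊕ Fin d → K) n = MvPowerSeries.X (Sum.inr n) := by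
  classical
  refine (S.shiftedCoord_eq (fun n' => ?_) (fun β hβ h => ?_) fun β hβ h => ?_).symm
  · rw [MvPowerSeries.coeff_X]
    have : (fun i => (0 : S.MPlus ⊕ Fin d → K) (Sum.inr i)) = 0 := rfl
    rw [this, taylorCoeff_zero]
    by_cases hn : n' = n
    · subst hn; simp
    · rw [if_neg, if_neg]
      · exact fun h => hn (Finsupp.equivFunOnFinite.symm.injective h)
      · exact fun h => hn (inr_single_injective h)
  · rw [MvPowerSeries.coeff_X, if_neg]
    · rfl
    · rintro rfl
      exact S.single_inr_notMem_N _ hβ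
  · rw [MvPowerSeries.coeff_X, if_neg]
    rintro rfl
    exact hβ ⟨n, rfl⟩

/-- The coefficient of `z_{n'}` in `y n` forces `n ≤ n'`, any other coefficient forces `|n| < η +
|β|`; both leave finitely many `n`. The second bound is where the restriction to `MPlus` enters. -/
theorem hasSubst_shiftedCoord (w : S.MPlus ⊕ Fin d → K) :
    MvPowerSeries.HasSubst (S.image (S.shiftedCoord w)) := by
  refine S.hasSubst_image (fun n => ?_) fun β => ?_
  · rw [← MvPowerSeries.coeff_zero_eq_constantCoeff_apply]
    refine S.coeff_shiftedCoord_of_not w n ?_ ?_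
    · rintro ⟨n, h⟩
      simp at h
    · rintro ⟨h, -⟩
      have := h.2
      simp [noiseHom] at this
  · by_cases hP : β ∈ P d Λ
    · obtain ⟨n', rfl⟩ := hP
      refine (Set.finite_Iic n').subset fun n hn => ?_
      simp only [Set.mem_ofPred_eq, coeff_shiftedCoord_single] at hn
      by_contra h
      exact hn (taylorCoeff_eq_zero _ fun h' => h h')
    · refine (S.finite_deg_le (S.η + S.hom β)).subset fun n hn => ?_
      by_contra h
      exact hn (S.coeff_shiftedCoord_of_not w n hP fun h' => h h'.2.le)

theorem mapDeriv_polyCoord [Algebra ℝ K] (δ : Derivation ℝ K K) (h : Fin d → K)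
    (n : Fin d → ℕ) : mapDeriv δ (polyCoord Λ h n) =
      ∑ i, MvPowerSeries.C (δ (h i)) * (((n i : ℝ) + 1) • polyCoord Λ h (n + Pi.single i 1)) := by
  classical
  ext β
  rw [coeff_mapDeriv, map_sum]
  by_cases hP : β ∈ P d Λ
  · obtain ⟨n', rfl⟩ := hP
    rw [coeff_polyCoord_single, deriv_taylorCoeff δ h Finset.univ _ _ (by simp)]
    refine Finset.sum_congr rfl fun i _ => ?_
    rw [MvPowerSeries.coeff_C_mul, ← toMI_add_single, ← coeff_polyCoord_single (Λ := Λ)]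
    rfl
  · rw [coeff_polyCoord_of_notMem _ _ hP, map_zero]
    refine (Finset.sum_eq_zero fun i _ => ?_).symm
    rw [MvPowerSeries.coeff_C_mul]
    have : MvPowerSeries.coeff β (((n i : ℝ) + 1) • polyCoord Λ h (n + Pi.single i 1)) =
      ((n i : ℝ) + 1) • MvPowerSeries.coeff β (polyCoord Λ h (n + Pi.single i 1)) := rfl
    rw [this, coeff_polyCoord_of_notMem _ _ hP, smul_zero, mul_zero]

end Coordinates

/-! ### The differential equations of the translations -/

/-- The universal translation, with coefficients in `T⁺`. -/
def univTransl : Poly d Λ →ₐ[ℝ] MvPowerSeries (Coord d Λ) S.TPlus :=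
  S.transl (S.shiftedCoord MvPolynomial.X)

/-- The parameters of the universal shift. -/
def shiftParam : S.MPlus ⊕ Fin d → S.TPlus :=
  Sum.elim 0 fun i => MvPolynomial.X (Sum.inr i)

/-- The series `y n` is affine in the noise parameters, with `Z_(γ,n)` multiplying `z^γ`. The
formula is parallel to `rho_insertGen`. -/
theorem mapDeriv_univTransl (x : S.MPlus) (f : Poly d Λ) :
    mapDeriv (MvPolynomial.pderiv (Sum.inl x)) (S.univTransl f) =
      MvPowerSeries.monomial x.1.1.1 1 * S.univTransl (S.D x.1.2 f) := by
  classical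
  have hy : ∀ n, mapDeriv (MvPolynomial.pderiv (Sum.inl x))
      (S.shiftedCoord (MvPolynomial.X : S.MPlus ⊕ Fin d → S.TPlus) n) =
      if n = x.1.2 then MvPowerSeries.monomial x.1.1.1 1 else 0 := fun n => by
    rw [shiftedCoord, map_add, mapDeriv_polyCoord, Finset.sum_eq_zero, zero_add]
    · ext β
      rw [coeff_mapDeriv]
      by_cases h : β ∈ S.N ∧ S.deg n < S.η + S.hom β
      · rw [coeff_noisePart S _ n h.1 h.2, MvPolynomial.pderiv_X, Pi.single_apply]
        obtain ⟨⟨⟨γ, hγ⟩, n'⟩, hx⟩ := x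
        by_cases hn : n = n'
        · subst hn
          simp only [if_true, MvPowerSeries.coeff_monomial, Sum.inl.injEq, Subtype.mk.injEq,
            Prod.mk.injEq, and_true]
        · rw [if_neg, if_neg hn, map_zero]
          simp [hn]
      · rw [coeff_noisePart_of_not S _ n h, map_zero]
        split_ifs with hn
        · rw [MvPowerSeries.coeff_monomial, if_neg]
          rintro rfl
          exact h ⟨x.1.1.2, hn ▸ x.2⟩
        · rw [map_zero]
    · intro i _
      rw [MvPolynomial.pderiv_X, Pi.single_apply, if_neg (by simp), map_zero, zero_mul]
  refine AlgHom.deriv_comp_eq _ _ _ _ (fun y => ?_) f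
  rw [univTransl, transl_X]
  rcases y with ⟨l, k⟩ | n
  · rw [mapDeriv_image_inl S _ _ (F := {x.1.2})]
    · rw [Finset.sum_singleton, hy, if_pos rfl]
    · intro n _ hn
      rw [hy, if_neg (by simpa using hn)]
  · rw [D_X_inr]
    refine (hy n).trans ?_
    split_ifs
    · rw [map_one (S.transl _), mul_one]
    · rw [map_zero, mul_zero]

theorem shiftedCoord_shiftParam (n : Fin d → ℕ) : S.shiftedCoord S.shiftParam n =
    polyCoord Λ (fun i => (MvPolynomial.X (Sum.inr i) : S.TPlus)) n := by
  ext β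
  rw [shiftedCoord, map_add]
  have : MvPowerSeries.coeff β (S.noisePart (fun x => S.shiftParam (Sum.inl x)) n) = 0 := by
    by_cases h : β ∈ S.N ∧ S.deg n < S.η + S.hom β
    · rw [coeff_noisePart S _ n h.1 h.2]; rfl
    · exact coeff_noisePart_of_not S _ n h
  rw [this, add_zero]
  rfl

/-- With vanishing noise parameters, differentiating `y n` in `Zᵢ` gives `(n(i)+1) y (n+eᵢ)`, the
image of `∂ᵢ z_n`. With a noise part this would fail, since `y (n+eᵢ)` has its own. It is needed
only here because `∂^m` is innermost in `DJm`. -/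
theorem mapDeriv_transl_shiftParam (i : Fin d) (f : Poly d Λ) :
    mapDeriv (MvPolynomial.pderiv (Sum.inr i)) (S.transl (S.shiftedCoord S.shiftParam) f) =
      S.transl (S.shiftedCoord S.shiftParam) (S.dx i f) := by
  classical
  have hy : ∀ n, mapDeriv (MvPolynomial.pderiv (Sum.inr i)) (S.shiftedCoord S.shiftParam n) =
      ((n i : ℝ) + 1) • S.shiftedCoord S.shiftParam (n + Pi.single i 1) := fun n => by
    rw [shiftedCoord_shiftParam, mapDeriv_polyCoord, Finset.sum_eq_single i,
      MvPolynomial.pderiv_X_self, map_one, one_mul, shiftedCoord_shiftParam]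
    · intro j _ hj
      rw [MvPolynomial.pderiv_X_of_ne (by simpa using hj), map_zero, zero_mul]
    · simp
  rw [AlgHom.deriv_comp_eq _ _ 1 (S.dx i) (fun y => ?_) f, one_mul]
  rw [transl_X, one_mul]
  rcases y with ⟨l, k⟩ | n
  · have hF : ∀ n, S.deg n < S.η → n ∈ (S.finite_deg_le S.η).toFinset := fun n hn => by
      simpa using hn.le
    rw [mapDeriv_image_inl S _ _ fun n hn hn' => absurd (hF n hn) hn', dx_X_inl S i l k hF, map_sum]
    refine Finset.sum_congr rfl fun n _ => ?_
    rw [hy, map_smul, map_mul, transl_X, smul_mul_assoc]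
    rfl
  · rw [dx_X_inr, map_smul, transl_X]
    exact hy n

/-! ### The coefficients of the universal translation -/

/-- The constant term is the value at `Z = 0`, where the parameters vanish and the translation is
the inclusion. -/
theorem coeff_zero_transl (f : Poly d Λ) (β : MI (Coord d Λ)) {w : S.MPlus ⊕ Fin d → S.TPlus}
    (hw : ∀ x, MvPolynomial.constantCoeff (w x) = 0) :
    (MvPowerSeries.coeff β (S.transl (S.shiftedCoord w) f)).coeff 0 = f.coeff β := by
  have h := S.map_transl (MvPolynomial.aeval (0 : S.MPlus ⊕ Fin d → ℝ)) (S.shiftedCoord w) f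
  simp only [map_shiftedCoord] at h
  have h0 : (fun x => ((MvPolynomial.aeval (0 : S.MPlus ⊕ Fin d → ℝ) : S.TPlus →ₐ[ℝ] ℝ) :
      S.TPlus →+* ℝ) (w x)) = 0 := by
    ext x
    simpa using hw x
  simp only [h0, shiftedCoord_zero] at h
  have h := congrArg (MvPowerSeries.coeff β) h
  rw [MvPowerSeries.coeff_map, coeff_transl_X] at h
  simpa [MvPolynomial.constantCoeff_eq] using h

theorem coeff_aeval_shiftParam (q : S.TPlus) (m : MI (Fin d)) :
    (MvPolynomial.aeval S.shiftParam q : S.TPlus).coeff (Finsupp.sumElim 0 m) =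
      q.coeff (Finsupp.sumElim 0 m) := by
  classical
  induction q using MvPolynomial.induction_on' with
  | add p q hp hq => rw [map_add, MvPolynomial.coeff_add, MvPolynomial.coeff_add, hp, hq]
  | monomial s a =>
    by_cases hs : ∃ x, s (Sum.inl x) ≠ 0
    · obtain ⟨x, hx⟩ := hs
      rw [MvPolynomial.aeval_monomial, Finsupp.prod,
        Finset.prod_eq_zero (Finsupp.mem_support_iff.2 hx), mul_zero, MvPolynomial.coeff_zero,
        MvPolynomial.coeff_monomial, if_neg]
      · rintro rfl
        exact hx rfl
      · exact zero_pow hx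
    · push Not at hs
      rw [MvPolynomial.aeval_monomial, MvPolynomial.monomial_eq, MvPolynomial.algebraMap_eq]
      congr 2
      refine Finsupp.prod_congr fun x hx => ?_
      rcases x with x | i
      · exact absurd (hs x) (Finsupp.mem_support_iff.1 hx)
      · rfl

/-- Each `∂ᵢ` becomes a derivative in `Zᵢ`, which moves the coefficient index by one unit; the
factorials absorb the resulting factors. -/
theorem coeff_transl_dx_list (L : List (Fin d)) (k : MI (S.MPlus ⊕ Fin d)) (f : Poly d Λ)
    (β : MI (Coord d Λ)) :
    ((k.prod fun _ j => j ! : ℕ) : ℝ) * (MvPowerSeries.coeff β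
      (S.transl (S.shiftedCoord S.shiftParam) (S.rho
        (L.map fun i => (UniversalEnvelopingAlgebra.ι ℝ (S.dxL i) : S.UL)).prod f))).coeff k =
    (((k + (L.map fun i => Finsupp.single (Sum.inr i) 1).sum).prod fun _ j => j ! : ℕ) : ℝ) *
      (MvPowerSeries.coeff β (S.transl (S.shiftedCoord S.shiftParam) f)).coeff
        (k + (L.map fun i => Finsupp.single (Sum.inr i) 1).sum) := by
  induction L generalizing k with
  | nil => simp
  | cons i L ih =>
    rw [List.map_cons, List.prod_cons, map_mul, Module.End.mul_apply, rho_ι]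
    have : ((S.dxL i : S.L) : Derivation ℝ (Poly d Λ) (Poly d Λ)) = S.dx i := rfl
    rw [this, ← mapDeriv_transl_shiftParam, coeff_mapDeriv, MvPolynomial.coeff_pderiv,
      List.map_cons, List.sum_cons, ← add_assoc, ← ih, prod_factorial_add_single]
    push_cast
    ring

/-- Induction on `L`: one derivative in `Z_(γ,n)` strips off the outermost `insertGen`, by
`mapDeriv_univTransl` and `rho_insertGen`. -/
theorem coeff_univTransl_list (L : List S.MPlus) (m : Fin d → ℕ) (f : Poly d Λ)
    (β : MI (Coord d Λ)) :
    (((Finsupp.sumElim (L.map fun x => (Finsupp.single x 1 : MI S.MPlus)).sum (toMI m)).prod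
        fun _ j => j ! : ℕ) : ℝ) * (MvPowerSeries.coeff β (S.univTransl f)).coeff
      (Finsupp.sumElim (L.map fun x => (Finsupp.single x 1 : MI S.MPlus)).sum (toMI m)) =
    (S.rho ((L.map Subtype.val).foldr S.insertGen (S.dxPow m)) f).coeff β := by
  classical
  induction L generalizing f β with
  | nil =>
    rw [List.map_nil, List.sum_nil, List.map_nil, List.foldr_nil]
    -- The monomial `Z^(0,m)` contains no noise variable, so the noise parameters may be set to
    -- zero.
    have h : (MvPowerSeries.coeff β (S.univTransl f)).coeff (Finsupp.sumElim 0 (toMI m)) =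
        (MvPowerSeries.coeff β (S.transl (S.shiftedCoord S.shiftParam) f)).coeff
          (Finsupp.sumElim 0 (toMI m)) := by
      rw [← coeff_aeval_shiftParam, univTransl]
      have h := congrArg (MvPowerSeries.coeff β) (S.map_transl (MvPolynomial.aeval S.shiftParam)
        (S.shiftedCoord (MvPolynomial.X : S.MPlus ⊕ Fin d → S.TPlus)) f)
      simp only [map_shiftedCoord, MvPowerSeries.coeff_map] at h
      simp only [RingHom.coe_coe, MvPolynomial.aeval_X] at h
      rw [h]
    obtain ⟨L, hL, hm⟩ := S.dxPow_eq_list_prod m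
    have hsum : Finsupp.sumElim 0 (toMI m) =
        0 + (L.map fun i => (Finsupp.single (Sum.inr i) 1 : MI (S.MPlus ⊕ Fin d))).sum := by
      rw [← hm, zero_add]
      clear hm hL
      induction L with
      | nil => simp
      | cons i L ih =>
        rw [List.map_cons, List.sum_cons, List.map_cons, List.sum_cons, ← ih,
          ← Finsupp.sumElim_zero_single, ← Finsupp.sumElim_add, zero_add]
    rw [h, hsum, ← coeff_transl_dx_list, hL, coeff_zero_transl]
    · simp
    · rintro (x | i) <;> simp [shiftParam]
  | cons x L ih =>
    rw [List.map_cons, List.sum_cons, List.map_cons, List.foldr_cons, rho_insertGen,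
      MvPolynomial.coeff_monomial_mul', one_mul]
    have hadd : Finsupp.sumElim (Finsupp.single x 1 +
        (L.map fun x => (Finsupp.single x 1 : MI S.MPlus)).sum) (toMI m) =
        Finsupp.sumElim (L.map fun x => (Finsupp.single x 1 : MI S.MPlus)).sum (toMI m) +
          Finsupp.single (Sum.inl x) 1 := by
      rw [← Finsupp.sumElim_single_zero, ← Finsupp.sumElim_add, add_zero, add_comm]
    rw [hadd, prod_factorial_add_single]
    have h := congrArg (fun g => (MvPowerSeries.coeff β g).coeff
      (Finsupp.sumElim (L.map fun x => (Finsupp.single x 1 : MI S.MPlus)).sum (toMI m)))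
      (S.mapDeriv_univTransl x f)
    simp only [coeff_mapDeriv, MvPolynomial.coeff_pderiv, MvPowerSeries.coeff_monomial_mul,
      one_mul] at h
    rw [Nat.cast_mul, Nat.cast_add, Nat.cast_one, mul_assoc, mul_left_comm,
      mul_comm ((_ : ℝ) + 1), h]
    split_ifs with hle
    · exact ih _ _
    · simp

/-- This replaces the enveloping algebra by an explicit algebra morphism. The normalisation `1/(J!
m!)` is that of a Taylor coefficient. -/
theorem actCoeffPlus_eq (J : MI S.MPlus) (m : Fin d → ℕ) (β γ : MI (Coord d Λ)) :
    S.actCoeffPlus J m β γ = (MvPowerSeries.coeff β (S.univTransl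
      (MvPolynomial.monomial γ 1))).coeff (Finsupp.sumElim J (toMI m)) := by
  classical
  rw [actCoeffPlus, actCoeff, DJm]
  -- The list chosen in `DJm` is lifted to `MPlus` with its order, so commutativity of the
  -- insertions is not needed.
  obtain ⟨L, hL⟩ : ∃ L : List S.MPlus, L.map Subtype.val =
      (Finsupp.toMultiset (J.mapDomain Subtype.val)).toList := by
    have : (Finsupp.toMultiset (J.mapDomain Subtype.val)).toList ∈
        Set.range (List.map (Subtype.val : S.MPlus → S.M)) := by
      rw [Set.range_list_map]
      intro x hx
      rw [Multiset.mem_toList, ← Finsupp.toMultiset_map, Multiset.mem_map] at hx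
      obtain ⟨y, -, rfl⟩ := hx
      exact ⟨y, rfl⟩
    exact this
  have hJ : (L : Multiset S.MPlus) = Finsupp.toMultiset J := by
    refine Multiset.map_injective Subtype.val_injective ?_
    rw [Finsupp.toMultiset_map, Multiset.map_coe, hL, Multiset.coe_toList]
  have hJ' : (L.map fun x => (Finsupp.single x 1 : MI S.MPlus)).sum = J := by
    refine Finsupp.orderIsoMultiset.injective ?_
    rw [Finsupp.coe_orderIsoMultiset, ← hJ, map_list_sum, List.map_map]
    clear hJ hL
    induction L with
    | nil => simp
    | cons x L ih =>
      rw [List.map_cons, List.sum_cons, ih, Function.comp_apply, Finsupp.toMultiset_single,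
        one_nsmul, Multiset.singleton_add, Multiset.cons_coe]
  have h := S.coeff_univTransl_list L m (MvPolynomial.monomial γ 1) β
  rw [hJ', hL] at h
  rw [map_smul, LinearMap.smul_apply, MvPolynomial.coeff_smul, ← h, smul_eq_mul, ← mul_assoc]
  have hp : ((Finsupp.sumElim J (toMI m)).prod fun _ j => j !) =
      ((J.mapDomain Subtype.val).prod fun _ j => j !) * ∏ i, (m i)! := by
    rw [Finsupp.prod_sumElim, Finsupp.prod_mapDomain_index_inj Subtype.val_injective]
    congr 1
    rw [Finsupp.prod_fintype _ _ (fun _ => rfl)]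
    rfl
  rw [hp, inv_mul_cancel₀, one_mul]
  rw [← hp]
  exact_mod_cast (Finset.prod_pos fun _ _ => Nat.factorial_pos _).ne'

end Setting

/-! ### Lower bound and local finiteness of the homogeneities -/

/-- Sums of elements of a finite set with bounded total absolute value take finitely many values. -/
theorem finite_sums {ι : Type*} (u : ι → ℝ) {W : Set ℝ} (hW : W.Finite) (C : ℝ) :
    {t : ℝ | ∃ f : ι →₀ ℕ, (∀ i, f i ≠ 0 → u i ∈ W) ∧ (f.sum fun i j => |u i| * j) ≤ C ∧
      t = f.sum fun i j => u i * j}.Finite := by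
  classical
  -- Only the multiplicity of each value `v` of `u` matters, and it is at most `C / |v|`. The
  -- multiplicity of `0` is uncontrolled but contributes nothing, so it is erased.
  refine ((Set.finite_Iic (∑ v ∈ hW.toFinset, Finsupp.single v ⌈C / |v|⌉₊)).image
    fun g : ℝ →₀ ℕ => g.sum fun v j => v * j).subset ?_
  rintro t ⟨f, hf, hC, rfl⟩
  have hmap : ∀ q : ℝ → ℝ, ((f.mapDomain u).sum fun v j => q v * j) =
      f.sum fun i j => q (u i) * j := fun q =>
    Finsupp.sum_mapDomain_index (by simp) (by intros; push_cast; ring)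
  have herase : ∀ q : ℝ → ℝ, q 0 = 0 → (((f.mapDomain u).erase 0).sum fun v j => q v * j) =
      f.sum fun i j => q (u i) * j := fun q hq => by
    rw [← hmap, ← Finsupp.add_sum_erase' (f.mapDomain u) 0 (fun v j => q v * (j : ℝ)) (by simp)]
    simp [hq]
  refine ⟨(f.mapDomain u).erase 0, fun v => ?_, herase (fun v => v) rfl⟩
  by_cases hv : (f.mapDomain u).erase 0 v = 0
  · rw [hv]; exact Nat.zero_le _
  have hv0 : v ≠ 0 := by
    rintro rfl
    exact hv Finsupp.erase_same
  have hvW : v ∈ W := by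
    rw [Finsupp.erase_ne hv0] at hv
    obtain ⟨i, hi, rfl⟩ := Finset.mem_image.1 (Finsupp.mapDomain_support
      (Finsupp.mem_support_iff.2 hv))
    exact hf i (Finsupp.mem_support_iff.1 hi)
  have hle : |v| * ((f.mapDomain u).erase 0 v : ℝ) ≤ C := by
    refine le_trans ?_ ((herase (fun v => |v|) abs_zero).trans_le hC)
    exact Finset.single_le_sum (f := fun v => |v| * (((f.mapDomain u).erase 0) v : ℝ))
      (fun _ _ => by positivity) (Finsupp.mem_support_iff.2 hv)
  rw [Finsupp.finsetSum_apply]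
  refine le_trans ?_ (Finset.single_le_sum (fun _ _ => Nat.zero_le _) (hW.mem_toFinset.2 hvW))
  rw [Finsupp.single_eq_same]
  refine Nat.cast_le.1 (le_trans ?_ (Nat.le_ceil (C / |v|)))
  rw [le_div_iff₀ (abs_pos.2 hv0), mul_comm]
  exact hle

namespace Setting

variable (S : Setting d Λ)

theorem hom_add (β γ : MI (Coord d Λ)) : S.hom (β + γ) = S.hom β + S.hom γ := by
  classical
  unfold hom
  rw [Finsupp.sum_add_index'] <;> intros <;> push_cast <;> ring

theorem hom_inl (l : Option Λ) (k : MI (Fin d → ℕ)) :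
    S.hom (Finsupp.single (Sum.inl (l, k)) 1) =
      S.α l + k.sum fun n j => (S.η - S.deg n) * j := by
  simp [hom]

theorem hom_inr (n : Fin d → ℕ) :
    S.hom (Finsupp.single (Sum.inr n : Coord d Λ) 1) = S.deg n - S.η := by
  simp [hom]

/-- The contribution of a coordinate to `|β| + (η - regsol) [β]`. -/
def weight : Coord d Λ → ℝ :=
  Sum.elim (fun lk => S.α lk.1 + (S.η - S.regsol) + lk.2.sum fun n j => (S.regsol - S.deg n) * j)
    (fun n => S.deg n - S.regsol)

/-- The length of `k` enters `|β|` with factor `η` and `[β]` with factor `-1`, so adding `(η -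
regsol) [β]` turns `η - |n|` into `regsol - |n|`, the quantity controlled by subcriticality. -/
theorem hom_add_bracket (β : MI (Coord d Λ)) :
    S.hom β + (S.η - S.regsol) * bracket β = β.sum fun x j => S.weight x * j := by
  rw [hom, bracket, Finsupp.sum, Finsupp.sum, Finsupp.sum, Int.cast_sum, Finset.mul_sum,
    ← Finset.sum_add_distrib]
  refine Finset.sum_congr rfl fun x _ => ?_
  rcases x with ⟨l, k⟩ | n
  · simp only [Sum.elim_inl, weight]
    have h : (k.sum fun n j => (S.η - S.deg n) * (j : ℝ)) =
        (S.η - S.regsol) * ((k.sum fun _ j => j : ℕ) : ℝ) +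
          k.sum fun n j => (S.regsol - S.deg n) * (j : ℝ) := by
      rw [Finsupp.sum, Finsupp.sum, Finsupp.sum, Nat.cast_sum, Finset.mul_sum,
        ← Finset.sum_add_distrib]
      refine Finset.sum_congr rfl fun n _ => by ring
    rw [h]
    push_cast
    ring
  · simp only [Sum.elim_inr, weight]
    push_cast
    ring

variable {S}

theorem Subcritical.lt_sum {l : Option Λ} {k : MI (Fin d → ℕ)} (h : S.Subcritical l k)
    {k' : MI (Fin d → ℕ)} (hk : k' ≤ k) :
    S.regsol < S.η + (S.reg l + k'.sum fun n j => (S.regsol - S.deg n) * j) := by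
  by_cases h0 : k' = 0
  · subst h0
    simpa using h.1
  · exact (h.2 k' h0 hk).2

theorem Subcritical.weight_pos {l : Option Λ} {k : MI (Fin d → ℕ)} (h : S.Subcritical l k) :
    0 < S.weight (Sum.inl (l, k)) := by
  have h1 := h.lt_sum le_rfl
  have h2 := S.reg_lt l
  simp only [weight, Sum.elim_inl]
  linarith

theorem weight_nonneg {β : MI (Coord d Λ)} (hβ : β ∈ S.NMin) {x : Coord d Λ} (hx : β x ≠ 0) :
    0 ≤ S.weight x := by
  rcases x with ⟨l, k⟩ | n
  · exact (hβ.2.1 l k hx).weight_pos.le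
  · have := fun h => hx (hβ.2.2 n h)
    simp only [weight, Sum.elim_inr]
    linarith [not_lt.1 this]

theorem hom_eq_sum_weight {β : MI (Coord d Λ)} (hβ : β ∈ S.NMin) :
    S.hom β + (S.η - S.regsol) = β.sum fun x j => S.weight x * j := by
  rw [← hom_add_bracket, hβ.1, Int.cast_one, mul_one]

theorem le_hom {β : MI (Coord d Λ)} (hβ : β ∈ S.NMin) : S.regsol - S.η ≤ S.hom β := by
  have h := hom_eq_sum_weight hβ
  have : 0 ≤ β.sum fun x j => S.weight x * (j : ℝ) :=
    Finset.sum_nonneg fun x hx => mul_nonneg (weight_nonneg hβ (Finsupp.mem_support_iff.1 hx))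
      (Nat.cast_nonneg _)
  linarith

variable (S)

/-- Since `|n| < η` on the support of `k`, the summands `regsol - |n|` take finitely many values.
Subcriticality bounds their negative part, and then `c` bounds the positive part. -/
theorem finite_weight_subcritical [Finite Λ] (c : ℝ) :
    {t : ℝ | ∃ l k, S.Subcritical l k ∧ S.weight (Sum.inl (l, k)) ≤ c ∧
      t = S.weight (Sum.inl (l, k))}.Finite := by
  classical
  have hW : ((fun n => S.regsol - S.deg n) '' {n | S.deg n ≤ S.η}).Finite :=
    (S.finite_deg_le S.η).image _
  refine (Set.finite_iUnion fun l : Option Λ => (finite_sums (fun n => S.regsol - S.deg n) hW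
    (c - S.α l - S.η + S.regsol + 2 * (S.η + S.reg l - S.regsol))).image
      fun t => S.α l + (S.η - S.regsol) + t).subset ?_
  rintro t ⟨l, k, hs, hc, rfl⟩
  refine Set.mem_iUnion.2 ⟨l, _, ⟨k, fun n hn => ⟨n, (hs.deg_lt hn).le, rfl⟩, ?_, rfl⟩, rfl⟩
  -- The sub-multi-index collecting exactly the negative summands. The absolute sum is the sum minus
  -- twice this part, whence the constant passed to `finite_sums`.
  have h1 := hs.lt_sum (k' := k.filter fun n => S.regsol < S.deg n) fun n => by
    rw [Finsupp.filter_apply]; split_ifs <;> omega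
  rw [Finsupp.sum_filter_index, Finsupp.support_filter, Finset.sum_filter] at h1
  have h2 : (k.sum fun n j => |S.regsol - S.deg n| * (j : ℝ)) =
      (k.sum fun n j => (S.regsol - S.deg n) * (j : ℝ)) - 2 * ∑ n ∈ k.support,
        if S.regsol < S.deg n then (S.regsol - S.deg n) * (k n : ℝ) else 0 := by
    rw [Finsupp.sum, Finsupp.sum, Finset.mul_sum, ← Finset.sum_sub_distrib]
    refine Finset.sum_congr rfl fun n _ => ?_
    split_ifs with h
    · rw [abs_of_neg (by linarith)]; ring
    · rw [abs_of_nonneg (by linarith)]; ring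
  rw [h2]
  simp only [weight, Sum.elim_inl] at hc
  linarith

/-- All weights in `β` are nonnegative, so each is bounded by the total and lies in a finite set;
then `finite_sums` applies. -/
theorem finite_hom_le [Finite Λ] (b : ℝ) : {t ∈ S.hom '' S.NMin | t ≤ b}.Finite := by
  have hW : ({t : ℝ | ∃ l k, S.Subcritical l k ∧ S.weight (Sum.inl (l, k)) ≤
      b + (S.η - S.regsol) ∧ t = S.weight (Sum.inl (l, k))} ∪
      (fun n => S.deg n - S.regsol) '' {n | S.deg n ≤ b + S.η}).Finite :=
    (S.finite_weight_subcritical _).union ((S.finite_deg_le _).image _)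
  refine ((finite_sums S.weight hW (b + (S.η - S.regsol))).image
    fun t => t - (S.η - S.regsol)).subset ?_
  rintro _ ⟨⟨β, hβ, rfl⟩, hb⟩
  have hsum := hom_eq_sum_weight hβ
  have hle : ∀ x, β x ≠ 0 → S.weight x ≤ b + (S.η - S.regsol) := fun x hx => by
    have h1 := Finset.single_le_sum (f := fun x => S.weight x * (β x : ℝ)) (s := β.support)
      (fun y hy => mul_nonneg (weight_nonneg hβ (Finsupp.mem_support_iff.1 hy))
        (Nat.cast_nonneg _)) (Finsupp.mem_support_iff.2 hx)
    have h2 : (1 : ℝ) ≤ β x := Nat.one_le_cast.2 (Nat.one_le_iff_ne_zero.2 hx)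
    have h3 := weight_nonneg hβ hx
    have h4 : (β.sum fun x j => S.weight x * (j : ℝ)) =
      ∑ x ∈ β.support, S.weight x * (β x : ℝ) := rfl
    nlinarith
  refine ⟨_, ⟨β, fun x hx => ?_, ?_, rfl⟩, by dsimp only; rw [← hsum]; ring⟩
  · rcases x with ⟨l, k⟩ | n
    · exact Or.inl ⟨l, k, hβ.2.1 l k hx, hle _ hx, rfl⟩
    · refine Or.inr ⟨n, ?_, rfl⟩
      have := hle _ hx
      simp only [weight, Sum.elim_inr] at this
      change S.deg n ≤ _
      linarith
  · have : (β.sum fun x j => |S.weight x| * (j : ℝ)) = β.sum fun x j => S.weight x * (j : ℝ) :=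
      Finset.sum_congr rfl fun x hx => by
        dsimp only
        rw [abs_of_nonneg (weight_nonneg hβ (Finsupp.mem_support_iff.1 hx))]
    rw [this, ← hsum]
    linarith

theorem bddBelow_A : BddBelow S.A := by
  refine ⟨min (S.regsol - S.η) (min S.regsol 0), ?_⟩
  rintro _ (⟨β, hβ, rfl⟩ | ⟨β, ⟨n, rfl⟩ | hβ, rfl⟩)
  · exact (min_le_left _ _).trans (le_hom hβ)
  · dsimp only
    rw [hom_inr]
    exact (min_le_right _ _).trans ((min_le_right _ _).trans (by linarith [S.deg_nonneg n]))
  · exact (min_le_right _ _).trans ((min_le_left _ _).trans (by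
      dsimp only; linarith [le_hom hβ.1]))

theorem finite_A_le [Finite Λ] (b : ℝ) : {t ∈ S.A | t ≤ b}.Finite := by
  refine ((S.finite_hom_le b).union (((S.finite_deg_le b).image S.deg).union
    ((S.finite_hom_le (b - S.η)).image fun t => t + S.η))).subset ?_
  rintro _ ⟨⟨β, hβ, rfl⟩ | ⟨β, ⟨n, rfl⟩ | hβ, rfl⟩, hb⟩
  · exact Or.inl ⟨⟨β, hβ, rfl⟩, hb⟩
  · dsimp only at hb ⊢
    rw [hom_inr, sub_add_cancel] at hb ⊢
    exact Or.inr (Or.inl ⟨n, hb, rfl⟩)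
  · exact Or.inr (Or.inr ⟨S.hom β, ⟨⟨β, hβ.1, rfl⟩, by dsimp only at hb; linarith⟩, rfl⟩)

/-- The rank of `β` is the number of homogeneities below `|β|`. Values are counted rather than
multi-indices, since only the former are known to be finitely many. -/
theorem wellFounded_hom [Finite Λ] : WellFounded fun γ β : S.N => S.hom γ < S.hom β := by
  have hfin : ∀ β : S.N, {t ∈ S.hom '' S.NMin | t < S.hom β}.Finite := fun β =>
    (S.finite_hom_le (S.hom β)).subset fun t ht => ⟨ht.1, ht.2.le⟩
  refine Subrelation.wf (r := InvImage (· < ·)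
    fun β : S.N => {t ∈ S.hom '' S.NMin | t < S.hom β}.ncard) ?_ (InvImage.wf _ wellFounded_lt)
  intro γ β h
  refine Set.ncard_lt_ncard ⟨fun t ht => ⟨ht.1, ht.2.trans h⟩, fun h' => ?_⟩ (hfin β)
  exact lt_irrefl _ (h' ⟨⟨γ, γ.2.1, rfl⟩, h⟩).2

end Setting

/-! ### Substitution into infinite linear combinations of variables -/

section Subst

variable {σ κ : Type*}

theorem coeff_eq_zero_of_dvd {f g : MvPowerSeries σ ℝ} (h : f ∣ g) {β : σ →₀ ℕ}
    (hf : ∀ β' ≤ β, MvPowerSeries.coeff β' f = 0) : MvPowerSeries.coeff β g = 0 := by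
  classical
  obtain ⟨q, rfl⟩ := h
  rw [MvPowerSeries.coeff_mul]
  refine Finset.sum_eq_zero fun x hx => ?_
  rw [hf x.1 (Finset.HasAntidiagonal.mem_antidiagonal.1 hx ▸ le_self_add), zero_mul]

/-- Substitution commutes with an infinite linear combination, coefficient by coefficient: for
almost all `k`, `a (e k)` has no coefficient at any `β' ≤ β`, so nothing divisible by it reaches
`β`. The finite set depends on `β` but not on `c`. -/
theorem exists_coeff_subst_varSum {a : σ → MvPowerSeries σ ℝ} (ha : MvPowerSeries.HasSubst a)
    {e : κ → σ} (he : Function.Injective e) (β : σ →₀ ℕ) :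
    ∃ F₀ : Finset κ, ∀ F, F₀ ⊆ F → ∀ c : κ → MvPowerSeries σ ℝ,
      MvPowerSeries.coeff β (MvPowerSeries.subst a (varSum e c)) =
        MvPowerSeries.coeff β (∑ k ∈ F, MvPowerSeries.subst a (c k) * a (e k)) := by
  classical
  have hfin : (⋃ β' ∈ Set.Iic β, {k | MvPowerSeries.coeff β' (a (e k)) ≠ 0}).Finite :=
    (Set.finite_Iic β).biUnion fun β' _ => (ha.coeff_zero β').preimage he.injOn
  refine ⟨hfin.toFinset, fun F hF c => ?_⟩
  have hsplit : varSum e c = ∑ k ∈ F, c k * MvPowerSeries.X (e k) +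
      varSum e fun k => if k ∈ F then 0 else c k := by
    have h1 : ∀ k ∈ F, c k * MvPowerSeries.X (e k) = varSum e fun j => if j = k then c k else 0 :=
      fun k _ => (varSum_ite k (c k)).symm
    rw [Finset.sum_congr rfl h1, ← varSum_sum he, ← varSum_add he]
    congr 1
    ext1 j
    by_cases hj : j ∈ F
    · rw [if_pos hj, add_zero, Finset.sum_eq_single j] <;> simp +contextual [hj, eq_comm]
    · rw [if_neg hj, Finset.sum_eq_zero, zero_add]
      intro k hk
      rw [if_neg]
      rintro rfl
      exact hj hk
  have hrest : MvPowerSeries.coeff β (MvPowerSeries.subst a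
      (varSum e fun k => if k ∈ F then 0 else c k)) = 0 := by
    rw [MvPowerSeries.coeff_subst ha]
    refine finsum_eq_zero_of_forall_eq_zero fun δ => ?_
    by_cases hδ : ∃ k, k ∉ F ∧ δ (e k) ≠ 0
    · obtain ⟨k, hk, hne⟩ := hδ
      rw [coeff_eq_zero_of_dvd (f := a (e k)) (g := δ.prod fun s j => a s ^ j), smul_zero]
      · exact (dvd_pow_self _ hne).trans
          (Finset.dvd_prod_of_mem _ (Finsupp.mem_support_iff.2 hne))
      · intro β' hβ'
        by_contra h
        exact hk (hF (hfin.mem_toFinset.2 (Set.mem_biUnion hβ' h)))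
    · push Not at hδ
      have : MvPowerSeries.coeff δ (varSum e fun k => if k ∈ F then 0 else c k) = 0 := by
        refine finsum_eq_zero_of_forall_eq_zero fun k => ?_
        dsimp only
        by_cases hk : k ∈ F
        · rw [if_pos hk, zero_mul, map_zero]
        · exact coeff_mul_X_eq_zero _ (hδ k hk)
      rw [this, zero_smul]
  rw [hsplit, MvPowerSeries.subst_add ha, map_add, hrest, add_zero]
  simp only [← MvPowerSeries.substAlgHom_apply ha, map_sum, map_mul, MvPowerSeries.substAlgHom_X]

end Subst

namespace Setting

variable (S : Setting d Λ)

/-- The composition law of translations on coordinates. -/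
theorem subst_image {y₁ y₂ : (Fin d → ℕ) → MvPowerSeries (Coord d Λ) ℝ}
    (ha : MvPowerSeries.HasSubst (S.image y₂)) (x : Coord d Λ) :
    MvPowerSeries.subst (S.image y₂) (S.image y₁ x) =
      S.image (fun n => MvPowerSeries.subst (S.image y₂) (y₁ n)) x := by
  classical
  rcases x with ⟨l, k⟩ | n
  swap
  · rfl
  by_cases hs : S.Subcritical l k
  swap
  · rw [image_inl_of_not S _ hs, image_inl_of_not S _ hs, MvPowerSeries.subst_X ha,
      image_inl_of_not S _ hs]
  rw [image_inl_of_subcritical S _ hs, image_inl_of_subcritical S _ hs]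
  ext β
  obtain ⟨F₀, hF₀⟩ := exists_coeff_subst_varSum ha (inl_injective l) β
  obtain ⟨G, hG⟩ := exists_finset_varSum (inl_injective (d := d) l) β
  set p₂ : (Fin d → ℕ) → MvPowerSeries (Coord d Λ) ℝ :=
    fun n => y₂ n - MvPowerSeries.X (Sum.inr n) with hp₂
  set q : (Fin d → ℕ) → MvPowerSeries (Coord d Λ) ℝ :=
    fun n => MvPowerSeries.subst (S.image y₂) (y₁ n) - y₂ n with hq
  have hadd : (fun n => MvPowerSeries.subst (S.image y₂) (y₁ n) - MvPowerSeries.X (Sum.inr n)) =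
      q + p₂ := by
    ext1 n
    simp only [hq, hp₂, Pi.add_apply]
    ring
  -- Large enough for the substitution at `β` and for every intermediate exponent `j` of
  -- `taylorCoeff_add`, for all relevant `k'`.
  set F := F₀ ∪ G.biUnion fun k' => (shiftPow p₂ k').support with hF
  rw [hF₀ F Finset.subset_union_left]
  have hterm : ∀ j ∈ F, MvPowerSeries.subst (S.image y₂) (if S.Subcritical l j then
      taylorCoeff (fun n => y₁ n - MvPowerSeries.X (Sum.inr n)) j k else 0) *
        S.image y₂ (Sum.inl (l, j)) =
      varSum (fun k => Sum.inl (l, k)) fun k' =>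
        taylorCoeff q j k * if S.Subcritical l k' then taylorCoeff p₂ k' j else 0 := fun j _ => by
    rw [← mul_varSum (inl_injective l), ← ite_image_inl]
    split_ifs with h
    · congr 1
      rw [← MvPowerSeries.substAlgHom_apply ha]
      have := map_taylorCoeff ((MvPowerSeries.substAlgHom ha : MvPowerSeries (Coord d Λ) ℝ →ₐ[ℝ]
        MvPowerSeries (Coord d Λ) ℝ) : MvPowerSeries (Coord d Λ) ℝ →+* MvPowerSeries (Coord d Λ) ℝ)
        (fun n => y₁ n - MvPowerSeries.X (Sum.inr n)) j k
      rw [RingHom.coe_coe] at this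
      rw [this]
      congr 1
      ext1 n
      rw [map_sub, MvPowerSeries.substAlgHom_X, MvPowerSeries.substAlgHom_apply]
      rfl
    · rw [← MvPowerSeries.substAlgHom_apply ha, map_zero, zero_mul, mul_zero]
  rw [Finset.sum_congr rfl hterm, ← varSum_sum (inl_injective l), coeff_varSum _ (hG β le_rfl),
    coeff_varSum _ (hG β le_rfl)]
  congr 1
  refine Finset.sum_congr rfl fun k' hk' => ?_
  congr 1
  split_ifs with h
  · rw [hadd, taylorCoeff_add]
    refine (Finset.sum_subset ?_ ?_).symm.trans (Finset.sum_congr rfl fun j _ => mul_comm _ _)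
    · exact (Finset.subset_biUnion_of_mem (fun k' => (shiftPow p₂ k').support) hk').trans
        Finset.subset_union_right
    · intro j _ hj
      rw [taylorCoeff, taylorCoeff, MvPolynomial.notMem_support_iff.1 hj, mul_zero]
  · simp

theorem subst_transl {y₁ y₂ : (Fin d → ℕ) → MvPowerSeries (Coord d Λ) ℝ}
    (ha : MvPowerSeries.HasSubst (S.image y₂)) (f : Poly d Λ) :
    MvPowerSeries.subst (S.image y₂) (S.transl y₁ f) =
      S.transl (fun n => MvPowerSeries.subst (S.image y₂) (y₁ n)) f := by
  rw [← MvPowerSeries.substAlgHom_apply ha]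
  have : (MvPowerSeries.substAlgHom ha).comp (S.transl y₁) =
      S.transl (fun n => MvPowerSeries.subst (S.image y₂) (y₁ n)) :=
    MvPolynomial.algHom_ext fun x => by
      rw [AlgHom.comp_apply, transl_X, transl_X, MvPowerSeries.substAlgHom_apply, subst_image S ha]
  exact DFunLike.congr_fun this f

theorem coeff_subst_image {y : (Fin d → ℕ) → MvPowerSeries (Coord d Λ) ℝ}
    (ha : MvPowerSeries.HasSubst (S.image y)) (f : MvPowerSeries (Coord d Λ) ℝ)
    (β : MI (Coord d Λ)) : MvPowerSeries.coeff β (MvPowerSeries.subst (S.image y) f) =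
      ∑ᶠ δ, MvPowerSeries.coeff δ f *
        MvPowerSeries.coeff β (S.transl y (MvPolynomial.monomial δ 1)) := by
  rw [MvPowerSeries.coeff_subst ha]
  simp only [transl, MvPolynomial.aeval_monomial, map_one, one_mul, smul_eq_mul]

theorem finite_coeff_subst_image {y : (Fin d → ℕ) → MvPowerSeries (Coord d Λ) ℝ}
    (ha : MvPowerSeries.HasSubst (S.image y)) (f : MvPowerSeries (Coord d Λ) ℝ)
    (β : MI (Coord d Λ)) : (Function.support fun δ => MvPowerSeries.coeff δ f *
        MvPowerSeries.coeff β (S.transl y (MvPolynomial.monomial δ 1))).Finite := by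
  have := MvPowerSeries.coeff_subst_finite ha f β
  simp only [transl, MvPolynomial.aeval_monomial, map_one, one_mul]
  exact this

/-! ### Homogeneity of the operators -/

/-- `E` changes the homogeneity by `c`. -/
def ShiftsHom (c : ℝ) (E : Module.End ℝ (Poly d Λ)) : Prop :=
  ∀ γ β, (E (MvPolynomial.monomial γ 1)).coeff β ≠ 0 → S.hom β = S.hom γ + c

variable {S}

theorem ShiftsHom.mul {c c' : ℝ} {E E' : Module.End ℝ (Poly d Λ)} (h : S.ShiftsHom c E)
    (h' : S.ShiftsHom c' E') : S.ShiftsHom (c + c') (E * E') := by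
  intro γ β hne
  rw [Module.End.mul_apply, MvPolynomial.as_sum (E' _), map_sum, MvPolynomial.coeff_sum] at hne
  obtain ⟨δ, hδ, hδ'⟩ := Finset.exists_ne_zero_of_sum_ne_zero hne
  have hsm : (MvPolynomial.monomial δ ((E' (MvPolynomial.monomial γ 1)).coeff δ) : Poly d Λ) =
      (E' (MvPolynomial.monomial γ 1)).coeff δ • MvPolynomial.monomial δ 1 := by
    rw [MvPolynomial.smul_monomial, smul_eq_mul, mul_one]
  rw [hsm, map_smul, MvPolynomial.coeff_smul, smul_eq_mul] at hδ'
  rw [h δ β (right_ne_zero_of_mul hδ'), h' γ δ (left_ne_zero_of_mul hδ')]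
  ring

theorem shiftsHom_one : S.ShiftsHom 0 1 := by
  classical
  intro γ β hne
  rw [Module.End.one_apply, MvPolynomial.coeff_monomial] at hne
  rw [add_zero]
  by_contra h
  rw [if_neg] at hne
  · exact hne rfl
  · rintro rfl
    exact h rfl

/-- A derivation replaces one factor `z_x` of a monomial by its image, and the homogeneity is
additive. -/
theorem ShiftsHom.of_derivation {c : ℝ} (E : Derivation ℝ (Poly d Λ) (Poly d Λ))
    (h : ∀ x β, (E (MvPolynomial.X x)).coeff β ≠ 0 →
      S.hom β = S.hom (Finsupp.single x 1) + c) : S.ShiftsHom c E.toLinearMap := by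
  classical
  intro γ β hne
  have hE : E = MvPolynomial.mkDerivation ℝ fun x => E (MvPolynomial.X x) :=
    MvPolynomial.derivation_ext fun x => by rw [MvPolynomial.mkDerivation_X]
  rw [Derivation.coeFn_coe, hE, MvPolynomial.mkDerivation_monomial, MvPolynomial.coeff_smul,
    Finsupp.sum, MvPolynomial.coeff_sum] at hne
  obtain ⟨x, hx, hne⟩ := Finset.exists_ne_zero_of_sum_ne_zero (right_ne_zero_of_mul hne)
  rw [smul_eq_mul, MvPolynomial.coeff_monomial_mul'] at hne
  split_ifs at hne with hle
  · have h1 := h x _ (right_ne_zero_of_mul hne)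
    have h2 := S.hom_add (γ - Finsupp.single x 1) (Finsupp.single x 1)
    have h3 := S.hom_add (β - (γ - Finsupp.single x 1)) (γ - Finsupp.single x 1)
    rw [tsub_add_cancel_of_le hle] at h3
    rw [tsub_add_cancel_of_le] at h2
    · rw [h3, h2, h1]; ring
    · rw [Finsupp.single_le_iff]
      exact Nat.one_le_iff_ne_zero.2 (Finsupp.mem_support_iff.1 hx)
  · exact absurd rfl hne

variable (S)

theorem shiftsHom_D (n : Fin d → ℕ) : S.ShiftsHom (S.η - S.deg n) (S.D n).toLinearMap := by
  classical
  refine ShiftsHom.of_derivation _ fun x β hne => ?_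
  rcases x with ⟨l, k⟩ | m
  · rw [D_X_inl] at hne
    split_ifs at hne
    · rw [MvPolynomial.coeff_smul, MvPolynomial.coeff_X] at hne
      split_ifs at hne with h
      · rw [← h, hom_inl, hom_inl, Finsupp.sum_add_index']
        · simp; ring
        · simp
        · intros; push_cast; ring
      · simp at hne
    · simp at hne
  · rw [D_X_inr] at hne
    split_ifs at hne with h
    · rw [MvPolynomial.coeff_one] at hne
      split_ifs at hne with h'
      · rw [← h', hom_inr, h]
        simp [hom]
      · exact absurd rfl hne
    · simp at hne

theorem shiftsHom_dx (i : Fin d) : S.ShiftsHom (S.s i) (S.dx i).toLinearMap := by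
  classical
  refine ShiftsHom.of_derivation _ fun x β hne => ?_
  rcases x with ⟨l, k⟩ | m
  · have hF : ∀ n, S.deg n < S.η → n ∈ (S.finite_deg_le S.η).toFinset := fun n hn => by
      simpa using hn.le
    rw [dx_X_inl S i l k hF, MvPolynomial.coeff_sum] at hne
    obtain ⟨n, -, hn⟩ := Finset.exists_ne_zero_of_sum_ne_zero hne
    rw [MvPolynomial.coeff_smul, MvPolynomial.X, MvPolynomial.coeff_monomial_mul', one_mul] at hn
    split_ifs at hn with hle
    · have h1 := S.shiftsHom_D n _ _ (right_ne_zero_of_mul hn)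
      have h2 := S.hom_add (β - Finsupp.single (Sum.inr (n + Pi.single i 1)) 1)
        (Finsupp.single (Sum.inr (n + Pi.single i 1)) 1)
      rw [tsub_add_cancel_of_le hle] at h2
      rw [h2, h1, hom_inr, deg_add_single]
      ring
    · simp at hn
  · rw [dx_X_inr, MvPolynomial.coeff_smul, MvPolynomial.coeff_X] at hne
    split_ifs at hne with h
    · rw [← h, hom_inr, hom_inr, deg_add_single]
      ring
    · simp at hne

theorem shiftsHom_dx_list (L : List (Fin d)) : S.ShiftsHom (L.map S.s).sum (S.rho
    (L.map fun i => (UniversalEnvelopingAlgebra.ι ℝ (S.dxL i) : S.UL)).prod) := by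
  induction L with
  | nil => simpa using shiftsHom_one
  | cons i L ih =>
    rw [List.map_cons, List.map_cons, List.sum_cons, List.prod_cons, map_mul]
    refine ShiftsHom.mul ?_ ih
    intro γ β hne
    rw [rho_ι] at hne
    exact S.shiftsHom_dx i γ β hne

theorem shiftsHom_foldr {c : ℝ} {U : S.UL} (hU : S.ShiftsHom c (S.rho U)) (L : List S.M) :
    S.ShiftsHom ((L.map fun p => S.η + S.hom p.1 - S.deg p.2).sum + c)
      (S.rho (L.foldr S.insertGen U)) := by
  induction L with
  | nil => simpa using hU
  | cons p L ih =>
    intro γ β hne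
    rw [List.foldr_cons, rho_insertGen, MvPolynomial.coeff_monomial_mul', one_mul] at hne
    split_ifs at hne with hle
    · have h1 := (ih.mul (S.shiftsHom_D p.2)) γ _ hne
      have h2 := S.hom_add (β - p.1.1) p.1.1
      rw [tsub_add_cancel_of_le hle] at h2
      rw [h2, h1, List.map_cons, List.sum_cons]
      ring
    · exact absurd rfl hne

/-! ### Triangularity of the universal translation -/

theorem exists_list_sum_single {I : Type*} (J : MI I) :
    ∃ L : List I, (L.map fun x => (Finsupp.single x 1 : MI I)).sum = J := by
  classical
  induction J using Finsupp.induction_linear with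
  | zero => exact ⟨[], rfl⟩
  | add J J' h h' =>
    obtain ⟨L, rfl⟩ := h
    obtain ⟨L', rfl⟩ := h'
    exact ⟨L ++ L', by simp⟩
  | single x j => exact ⟨List.replicate j x, by simp⟩

/-- The coefficient at `Z^Q` is, up to factorials, produced by one element of the enveloping
algebra. This transfers to translations both the gain of homogeneity and the invariance of `TN`. -/
theorem exists_rho_of_coeff_ne_zero {γ β : MI (Coord d Λ)} {Q : MI (S.MPlus ⊕ Fin d)}
    (h : (MvPowerSeries.coeff β (S.univTransl (MvPolynomial.monomial γ 1))).coeff Q ≠ 0) :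
    ∃ U : S.UL, ∃ c : ℝ, 0 ≤ c ∧ (Q ≠ 0 → 0 < c) ∧ S.ShiftsHom c (S.rho U) ∧
      (S.rho U (MvPolynomial.monomial γ 1)).coeff β ≠ 0 := by
  classical
  obtain ⟨⟨J, m'⟩, rfl⟩ := Finsupp.sumFinsuppEquivProdFinsupp.symm.surjective Q
  obtain ⟨m, rfl⟩ := Finsupp.equivFunOnFinite.symm.surjective m'
  obtain ⟨L, hL⟩ := exists_list_sum_single J
  obtain ⟨L', hL', hm⟩ := S.dxPow_eq_list_prod m
  have key := S.coeff_univTransl_list L m (MvPolynomial.monomial γ 1) β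
  rw [hL] at key
  have hpos : ∀ t ∈ (L.map Subtype.val).map fun p : S.M => S.η + S.hom p.1 - S.deg p.2, 0 < t := by
    intro t ht
    simp only [List.map_map, List.mem_map, Function.comp_apply] at ht
    obtain ⟨x, -, rfl⟩ := ht
    linarith [x.2]
  have hpos' : ∀ t ∈ L'.map S.s, 0 < t := by
    intro t ht
    obtain ⟨i, -, rfl⟩ := List.mem_map.1 ht
    linarith [S.one_le_s i]
  have h1 := List.sum_nonneg fun t ht => (hpos t ht).le
  have h2 := List.sum_nonneg fun t ht => (hpos' t ht).le
  refine ⟨_, _, add_nonneg h1 h2, fun hQ => ?_, S.shiftsHom_foldr (U := S.dxPow m) (by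
    rw [hL']; exact S.shiftsHom_dx_list L') (L.map Subtype.val), ?_⟩
  · by_cases hL0 : L = []
    · refine add_pos_of_nonneg_of_pos h1 (List.sum_pos _ hpos' fun h0 => hQ ?_)
      rw [List.map_eq_nil_iff] at h0
      subst hL0 h0
      have hm0 : Finsupp.equivFunOnFinite.symm m = 0 := hm.symm
      rw [hm0, ← hL]
      exact Finsupp.sumElim_zero_zero
    · exact add_pos_of_pos_of_nonneg (List.sum_pos _ hpos (by simpa using hL0)) h2
  · rw [← key]
    exact mul_ne_zero (by exact_mod_cast (Finset.prod_pos fun _ _ => Nat.factorial_pos _).ne') h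

theorem coeff_transl_eq_aeval (w : S.MPlus ⊕ Fin d → ℝ) (f : Poly d Λ) (β : MI (Coord d Λ)) :
    MvPowerSeries.coeff β (S.transl (S.shiftedCoord w) f) =
      MvPolynomial.aeval w (MvPowerSeries.coeff β (S.univTransl f)) := by
  have h := congrArg (MvPowerSeries.coeff β) (S.map_transl (MvPolynomial.aeval w)
    (S.shiftedCoord (MvPolynomial.X : S.MPlus ⊕ Fin d → S.TPlus)) f)
  simp only [map_shiftedCoord, MvPowerSeries.coeff_map] at h
  simp only [RingHom.coe_coe, MvPolynomial.aeval_X] at h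
  exact h.symm

/-- Every `Z^Q` with `Q ≠ 0` strictly raises the homogeneity, so only the constant term survives. -/
theorem coeff_transl_of_not_lt (w : S.MPlus ⊕ Fin d → ℝ) {γ β : MI (Coord d Λ)}
    (h : ¬ S.hom γ < S.hom β) :
    MvPowerSeries.coeff β (S.transl (S.shiftedCoord w) (MvPolynomial.monomial γ 1)) =
      (MvPolynomial.monomial γ (1 : ℝ)).coeff β := by
  have hC : MvPowerSeries.coeff β (S.univTransl (MvPolynomial.monomial γ 1)) =
      MvPolynomial.C ((MvPolynomial.monomial γ (1 : ℝ)).coeff β) := by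
    classical
    ext Q
    rw [MvPolynomial.coeff_C]
    split_ifs with hQ
    · subst hQ
      exact S.coeff_zero_transl _ _ fun x => by simp
    · by_contra hne
      obtain ⟨U, c, -, hc, hU, hne⟩ := S.exists_rho_of_coeff_ne_zero hne
      exact h (by linarith [hU _ _ hne, hc (Ne.symm hQ)])
  rw [coeff_transl_eq_aeval, hC, MvPolynomial.aeval_C]
  rfl

theorem exists_coeff_ne_zero (w : S.MPlus ⊕ Fin d → ℝ) {γ β : MI (Coord d Λ)}
    (h : MvPowerSeries.coeff β (S.transl (S.shiftedCoord w) (MvPolynomial.monomial γ 1)) ≠ 0) :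
    ∃ Q, (MvPowerSeries.coeff β (S.univTransl (MvPolynomial.monomial γ 1))).coeff Q ≠ 0 := by
  by_contra! h'
  refine h ?_
  have : MvPowerSeries.coeff β (S.univTransl (MvPolynomial.monomial γ 1)) = 0 :=
    MvPolynomial.ext _ _ h'
  rw [coeff_transl_eq_aeval, this, map_zero]

theorem hom_le_of_coeff_transl_ne_zero (w : S.MPlus ⊕ Fin d → ℝ) {γ β : MI (Coord d Λ)}
    (h : MvPowerSeries.coeff β (S.transl (S.shiftedCoord w) (MvPolynomial.monomial γ 1)) ≠ 0) :
    S.hom γ ≤ S.hom β := by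
  obtain ⟨Q, hQ⟩ := S.exists_coeff_ne_zero w h
  obtain ⟨U, c, hc, -, hU, hne⟩ := S.exists_rho_of_coeff_ne_zero hQ
  linarith [hU _ _ hne]

theorem rho_mem_TN (U : S.UL) {f : Poly d Λ} (hf : f ∈ S.TN) : S.rho U f ∈ S.TN := by
  induction U using UniversalEnvelopingAlgebra.induction_mul with
  | one => simpa using hf
  | smul c U h => simpa using Submodule.smul_mem _ c h
  | add U V hU hV => simpa using Submodule.add_mem _ hU hV
  | mul E U h =>
    rw [map_mul, Module.End.mul_apply, rho_ι]
    exact S.L_mem E.2 h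

theorem mem_N_of_coeff_transl_ne_zero (w : S.MPlus ⊕ Fin d → ℝ) {γ β : MI (Coord d Λ)}
    (h : MvPowerSeries.coeff β (S.transl (S.shiftedCoord w) (MvPolynomial.monomial γ 1)) ≠ 0)
    (hγ : γ ∈ S.N) : β ∈ S.N := by
  obtain ⟨Q, hQ⟩ := S.exists_coeff_ne_zero w h
  obtain ⟨U, -, -, -, -, hne⟩ := S.exists_rho_of_coeff_ne_zero hQ
  exact (MvPolynomial.mem_restrictSupport_iff _).1 (S.rho_mem_TN U (S.monomial_mem hγ 1))
    (MvPolynomial.mem_support_iff.2 hne)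

end Setting

/-! ### Auxiliary facts on sums and triangular systems -/

theorem finsum_subtype_eq {I : Type*} {s : Set I} {f : I → ℝ} (h : Function.support f ⊆ s) :
    ∑ᶠ i : s, f i = ∑ᶠ i, f i := by
  rw [finsum_set_coe_eq_finsum_mem, finsum_mem_def, Set.indicator_eq_self.2 h]

open Classical in
/-- Triangular systems of equations along a well-founded relation are solvable. -/
theorem exists_solution_of_wellFounded {I : Type*} {r : I → I → Prop} (hr : WellFounded r)
    (p : I → Prop) (g : I → ℝ) (c : I → I → ℝ) :
    ∃ u : I → ℝ, ∀ β, u β =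
      if p β then g β - ∑ᶠ δ, (if r δ β then u δ * c β δ else 0) else 0 := by
  refine ⟨hr.fix fun β u =>
    if p β then g β - ∑ᶠ δ, (if h : r δ β then u δ h * c β δ else 0) else 0, fun β => ?_⟩
  rw [hr.fix_eq]
  simp only [dite_eq_ite]

namespace Setting

variable (S : Setting d Λ)

theorem transl_single (y : (Fin d → ℕ) → MvPowerSeries (Coord d Λ) ℝ) (n : Fin d → ℕ) :
    S.transl y (MvPolynomial.monomial (Finsupp.single (Sum.inr n) 1) 1) = y n :=
  S.transl_X y (Sum.inr n)

/-! ### The composition of translations -/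

/-- The parameters of the composition of two translations. -/
def compParam (w₁ w₂ : S.MPlus ⊕ Fin d → ℝ) : S.MPlus ⊕ Fin d → ℝ :=
  Sum.elim (fun x => MvPowerSeries.coeff x.1.1.1
      (MvPowerSeries.subst (S.image (S.shiftedCoord w₂)) (S.shiftedCoord w₁ x.1.2)))
    fun i => w₁ (Sum.inr i) + w₂ (Sum.inr i)

theorem coeff_transl_of_notMem_N (w : S.MPlus ⊕ Fin d → ℝ) {δ β : MI (Coord d Λ)} (hδ : δ ∈ S.N)
    (hβ : β ∉ S.N) :
    MvPowerSeries.coeff β (S.transl (S.shiftedCoord w) (MvPolynomial.monomial δ 1)) = 0 := by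
  by_contra h
  exact hβ (S.mem_N_of_coeff_transl_ne_zero w h hδ)

theorem mem_of_coeff_shiftedCoord_ne_zero (w : S.MPlus ⊕ Fin d → ℝ) {n : Fin d → ℕ}
    {δ : MI (Coord d Λ)} (h : MvPowerSeries.coeff δ (S.shiftedCoord w n) ≠ 0) :
    (∃ n', n ≤ n' ∧ δ = Finsupp.single (Sum.inr n') 1) ∨
      (δ ∈ S.N ∧ S.deg n < S.η + S.hom δ) := by
  by_cases hP : δ ∈ P d Λ
  · obtain ⟨n', rfl⟩ := hP
    refine Or.inl ⟨n', ?_, rfl⟩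
    dsimp only at h
    rw [coeff_shiftedCoord_single] at h
    by_contra hn
    exact h (taylorCoeff_eq_zero _ fun h' => hn h')
  · by_contra h'
    push Not at h'
    exact h (S.coeff_shiftedCoord_of_not w n hP fun h'' => absurd h''.2 (not_lt.2 (h'.2 h''.1)))

/-- On `MPlus` the parameters are read off by definition. At pure monomials the noise part cannot
contribute, as translations preserve `N`, and the polynomial shifts add. Elsewhere nothing appears:
`z_{n'}` with `n ≤ n'` only yields `|n| ≤ |n'| < η + |β|`, and `z^δ` only yields `|β| ≥ |δ|`. -/
theorem subst_shiftedCoord (w₁ w₂ : S.MPlus ⊕ Fin d → ℝ) (n : Fin d → ℕ) :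
    MvPowerSeries.subst (S.image (S.shiftedCoord w₂)) (S.shiftedCoord w₁ n) =
      S.shiftedCoord (S.compParam w₁ w₂) n := by
  classical
  have ha := S.hasSubst_shiftedCoord w₂
  refine S.shiftedCoord_eq (fun n' => ?_) (fun β hβ h => rfl) fun β hβ h => ?_
  · set h₂ : Fin d → ℝ := fun i => w₂ (Sum.inr i) with hh₂
    have hadd : (fun i => S.compParam w₁ w₂ (Sum.inr i)) = (fun i => w₁ (Sum.inr i)) + h₂ := rfl
    have hinj : Function.Injective fun j : MI (Fin d) =>
        (Finsupp.single (Sum.inr (j : Fin d → ℕ)) 1 : MI (Coord d Λ)) :=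
      fun j j' h => DFunLike.coe_injective (inr_single_injective h)
    rw [coeff_subst_image S ha, hadd, taylorCoeff_add]
    rw [finsum_eq_sum_of_support_subset (s := (shiftPow h₂ (toMI n')).support.image
      fun j : MI (Fin d) => Finsupp.single (Sum.inr (j : Fin d → ℕ)) 1), Finset.sum_image hinj.injOn]
    · refine Finset.sum_congr rfl fun j _ => ?_
      rw [coeff_shiftedCoord_single, transl_single, coeff_shiftedCoord_single, mul_comm]
      simp [hh₂, toMI]
    · intro δ hδ
      rcases S.mem_of_coeff_shiftedCoord_ne_zero w₁ (left_ne_zero_of_mul hδ) with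
        ⟨n'', -, rfl⟩ | ⟨hδN, -⟩
      · rw [Finset.coe_image]
        refine ⟨toMI n'', ?_, rfl⟩
        have := right_ne_zero_of_mul hδ
        rw [transl_single, coeff_shiftedCoord_single] at this
        exact MvPolynomial.mem_support_iff.2 this
      · exact absurd (S.coeff_transl_of_notMem_N w₂ hδN (S.single_inr_notMem_N n'))
          (right_ne_zero_of_mul hδ)
  · rw [coeff_subst_image S ha]
    refine finsum_eq_zero_of_forall_eq_zero fun δ => ?_
    by_contra hδ
    rcases S.mem_of_coeff_shiftedCoord_ne_zero w₁ (left_ne_zero_of_mul hδ) with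
      ⟨n', hn, rfl⟩ | ⟨hδN, hdeg⟩
    · have h1 := right_ne_zero_of_mul hδ
      rw [transl_single] at h1
      rcases S.mem_of_coeff_shiftedCoord_ne_zero w₂ h1 with ⟨n'', -, rfl⟩ | ⟨h2, h3⟩
      · exact hβ ⟨n'', rfl⟩
      · exact h ⟨h2, (S.deg_mono hn).trans_lt h3⟩
    · have h1 := right_ne_zero_of_mul hδ
      have h2 := S.hom_le_of_coeff_transl_ne_zero w₂ h1
      exact h ⟨S.mem_N_of_coeff_transl_ne_zero w₂ h1 hδN, by linarith⟩

theorem mem_Pop_of_coeff_transl_ne_zero (w : S.MPlus ⊕ Fin d → ℝ) {γ β : MI (Coord d Λ)}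
    (h : MvPowerSeries.coeff β (S.transl (S.shiftedCoord w) (MvPolynomial.monomial γ 1)) ≠ 0)
    (hγ : γ ∈ S.Pop) : β ∈ S.Pop := by
  rcases hγ with ⟨n, rfl⟩ | hγ
  · dsimp only at h
    rw [transl_single] at h
    rcases S.mem_of_coeff_shiftedCoord_ne_zero w h with ⟨n', -, rfl⟩ | h
    · exact Or.inl ⟨n', rfl⟩
    · exact Or.inr h.1
  · exact Or.inr (S.mem_N_of_coeff_transl_ne_zero w h hγ)

/-- Every translation has a left inverse with respect to the composition of parameters. -/
theorem exists_compParam_eq_zero [Finite Λ] (w₂ : S.MPlus ⊕ Fin d → ℝ) :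
    ∃ w₁, S.compParam w₁ w₂ = 0 := by
  classical
  have ha := S.hasSubst_shiftedCoord w₂
  set h₁ : Fin d → ℝ := fun i => -w₂ (Sum.inr i)
  set c : MI (Coord d Λ) → MI (Coord d Λ) → ℝ := fun β δ => MvPowerSeries.coeff β
    (S.transl (S.shiftedCoord w₂) (MvPolynomial.monomial δ 1)) with hc
  -- The noise parameters must cancel the translated polynomial part. The equation at `β` involves
  -- `u n β` with coefficient one and otherwise only `u n δ` with `|δ| < |β|`. The default `0`
  -- outside `MPlus` makes `u n` agree with the coefficients of `noisePart`.
  choose u hu using fun n : Fin d → ℕ => exists_solution_of_wellFounded S.wellFounded_hom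
    (fun β => S.deg n < S.η + S.hom β) (fun β => -MvPowerSeries.coeff β.1
      (MvPowerSeries.subst (S.image (S.shiftedCoord w₂)) (polyCoord Λ h₁ n)))
    (fun β δ => c β δ)
  refine ⟨Sum.elim (fun x => u x.1.2 x.1.1) h₁, ?_⟩
  ext x
  rcases x with ⟨⟨β, n⟩, hx⟩ | i
  swap
  · simp [compParam, h₁]
  set v := S.noisePart (fun x => u x.1.2 x.1.1) n with hv
  have hcoeff : ∀ δ : S.N, MvPowerSeries.coeff δ.1 v = u n δ := fun δ => by
    by_cases hδ : S.deg n < S.η + S.hom δ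
    · rw [hv, coeff_noisePart S _ n δ.2 hδ]
    · rw [hv, coeff_noisePart_of_not S _ n fun h => hδ h.2, hu, if_neg hδ]
  have hsupp : Function.support (fun δ => MvPowerSeries.coeff δ v * c β δ) ⊆ S.N := by
    intro δ hδ
    by_contra h
    exact left_ne_zero_of_mul hδ (S.coeff_noisePart_of_not _ n fun h' => h h'.1)
  have hfin := S.finite_coeff_subst_image ha v β.1
  -- Unit triangularity of the translation: strictly lower terms plus the diagonal.
  have hsplit : ∀ δ : S.N, MvPowerSeries.coeff δ.1 v * c β δ =
      (if S.hom δ < S.hom β then u n δ * c β δ else 0) + if δ = β then u n β else 0 := fun δ => by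
    rw [hcoeff]
    by_cases hlt : S.hom δ < S.hom β
    · rw [if_pos hlt, if_neg, add_zero]
      rintro rfl
      exact lt_irrefl _ hlt
    · rw [if_neg hlt, zero_add, hc]
      dsimp only
      rw [coeff_transl_of_not_lt S _ hlt, MvPolynomial.coeff_monomial]
      by_cases he : δ = β
      · rw [if_pos he, if_pos (congrArg Subtype.val he), mul_one, he]
      · rw [if_neg he, if_neg fun h => he (Subtype.ext h), mul_zero]
  have hfin' : (Function.support fun δ : S.N => MvPowerSeries.coeff δ.1 v * c β δ).Finite :=
    hfin.preimage Subtype.val_injective.injOn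
  have hsum : ∑ᶠ δ, MvPowerSeries.coeff δ v * c β δ =
      ∑ᶠ δ : S.N, (if S.hom δ < S.hom β then u n δ * c β δ else 0) + u n β := by
    rw [← finsum_subtype_eq hsupp]
    simp only [hsplit]
    rw [finsum_add_distrib]
    · rw [finsum_eq_single (fun δ : S.N => if δ = β then u n β else 0) β fun δ hδ => if_neg hδ,
        if_pos rfl]
    · refine hfin'.subset fun δ hδ => ?_
      rw [Function.mem_support] at hδ ⊢
      split_ifs at hδ with h
      · rw [hcoeff]; exact hδ
      · exact absurd rfl hδ
    · refine (Set.finite_singleton β).subset fun δ hδ => ?_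
      by_contra h
      exact hδ (if_neg h)
  change MvPowerSeries.coeff β.1 (MvPowerSeries.subst (S.image (S.shiftedCoord w₂))
    (polyCoord Λ h₁ n + v)) = 0
  rw [MvPowerSeries.subst_add ha, map_add, coeff_subst_image S ha v, hsum, hu n β, if_pos hx]
  ring

/-! ### The structure group in terms of translations -/

theorem finite_actCoeffPlus (β : S.All) : {q : (MI S.MPlus × (Fin d → ℕ)) × S.All |
    S.actCoeffPlus q.1.1 q.1.2 β q.2 ≠ 0}.Finite := by
  have ha : MvPowerSeries.HasSubst (S.image (S.shiftedCoord
    (MvPolynomial.X : S.MPlus ⊕ Fin d → S.TPlus))) := S.hasSubst_shiftedCoord _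
  -- Substituting into the series with all coefficients one shows that only finitely many `γ` have a
  -- translate reaching `β`; each such coefficient is a polynomial, hence finitely many `(J, m)`.
  have hfin := MvPowerSeries.coeff_subst_finite (R := ℝ) ha
    (show MvPowerSeries (Coord d Λ) ℝ from fun _ => (1 : ℝ)) β.1
  refine Set.Finite.of_finite_image (f := fun q : (MI S.MPlus × (Fin d → ℕ)) × S.All =>
    (⟨q.2.1, Finsupp.sumElim q.1.1 (toMI q.1.2)⟩ : Σ _ : MI (Coord d Λ), MI (S.MPlus ⊕ Fin d)))
    ((hfin.toFinset.sigma fun γ => (MvPowerSeries.coeff β.1 (S.univTransl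
      (MvPolynomial.monomial γ 1))).support).finite_toSet.subset ?_) ?_
  · rintro _ ⟨q, hq, rfl⟩
    have hq' : (MvPowerSeries.coeff β.1 (S.univTransl (MvPolynomial.monomial q.2.1 1))).coeff
        (Finsupp.sumElim q.1.1 (toMI q.1.2)) ≠ 0 := by
      rw [← actCoeffPlus_eq]; exact hq
    simp only [Finset.coe_sigma, Set.mem_sigma_iff, Finset.mem_coe, MvPolynomial.mem_support_iff]
    refine ⟨?_, hq'⟩
    refine (Set.Finite.mem_toFinset hfin).2 fun h0 => ?_
    refine hq' ?_
    rw [univTransl, transl, MvPolynomial.aeval_monomial, map_one, one_mul]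
    replace h0 := (one_smul ℝ _).symm.trans h0
    rw [h0, MvPolynomial.coeff_zero]
  · rintro ⟨⟨J, m⟩, γ⟩ - ⟨⟨J', m'⟩, γ'⟩ - h
    simp only [Sigma.mk.injEq, heq_eq_eq] at h
    obtain ⟨h1, h2⟩ := h
    have h3 := Finsupp.sumFinsuppEquivProdFinsupp.symm.injective
      (a₁ := (J, toMI m)) (a₂ := (J', toMI m')) h2
    rw [Prod.mk.injEq] at h3
    rw [h3.1, Finsupp.equivFunOnFinite.symm.injective h3.2, Subtype.ext h1]

theorem ZMon_eq_monomial (J : MI S.MPlus) (m : Fin d → ℕ) :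
    S.ZMon J m = MvPolynomial.monomial (Finsupp.sumElim J (toMI m)) 1 := by
  rw [MvPolynomial.monomial_eq, Finsupp.prod_sumElim, ZMon, map_one, one_mul,
    Finsupp.prod_fintype (toMI m) _ fun _ => by simp]
  rfl

/-- The matrix of `Gam π` is the transpose of that of the translation whose parameters are the
values of `π` on the variables. -/
theorem Gam_single (π : S.TPlus →ₐ[ℝ] ℝ) (β γ : S.Pop) :
    S.Gam π (Finsupp.single β 1) γ = MvPowerSeries.coeff β.1 (S.transl
      (S.shiftedCoord fun x => π (MvPolynomial.X x)) (MvPolynomial.monomial γ.1 1)) := by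
  classical
  have hfin := S.finite_actCoeffPlus (S.popIncl β)
  have hco : S.coaction (Finsupp.single (S.popIncl β) 1) = ∑ q ∈ hfin.toFinset,
      S.actCoeffPlus q.1.1 q.1.2 β q.2 •
        (S.ZMon q.1.1 q.1.2 ⊗ₜ[ℝ] Finsupp.single q.2 (1 : ℝ)) := by
    rw [coaction, Finsupp.linearCombination_single, one_smul]
    refine finsum_eq_sum_of_support_subset _ fun q hq => ?_
    rw [Set.Finite.coe_toFinset]
    intro h
    refine hq ?_
    dsimp only
    rw [h, zero_smul]
  have hpoly : MvPowerSeries.coeff β.1 (S.univTransl (MvPolynomial.monomial γ.1 1)) =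
      ∑ q ∈ hfin.toFinset, S.actCoeffPlus q.1.1 q.1.2 β q.2 •
        if q.2 = S.popIncl γ then S.ZMon q.1.1 q.1.2 else 0 := by
    ext Q
    obtain ⟨⟨J, m'⟩, rfl⟩ := Finsupp.sumFinsuppEquivProdFinsupp.symm.surjective Q
    obtain ⟨m, rfl⟩ := Finsupp.equivFunOnFinite.symm.surjective m'
    change MvPolynomial.coeff (Finsupp.sumElim J (toMI m)) _ =
      MvPolynomial.coeff (Finsupp.sumElim J (toMI m)) _
    rw [← actCoeffPlus_eq, MvPolynomial.coeff_sum,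
      Finset.sum_eq_single ((J, m), S.popIncl γ)]
    · rw [if_pos rfl, ZMon_eq_monomial, MvPolynomial.coeff_smul, MvPolynomial.coeff_monomial,
        if_pos rfl, smul_eq_mul, mul_one]
      rfl
    · rintro ⟨⟨J', m'⟩, γ'⟩ - hne
      rw [MvPolynomial.coeff_smul]
      split_ifs with h
      · rw [ZMon_eq_monomial, MvPolynomial.coeff_monomial, if_neg, smul_zero]
        intro h2
        have h3 := Finsupp.sumFinsuppEquivProdFinsupp.symm.injective
          (a₁ := (J', toMI m')) (a₂ := (J, toMI m)) h2
        rw [Prod.mk.injEq] at h3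
        dsimp only at h
        exact hne (by rw [h3.1, Finsupp.equivFunOnFinite.symm.injective h3.2, h])
      · rw [MvPolynomial.coeff_zero, smul_zero]
    · intro h
      rw [Set.Finite.mem_toFinset, Set.mem_ofPred_eq, not_not] at h
      dsimp only
      have h' : S.actCoeffPlus J m β.1 (S.popIncl γ).1 = 0 := h
      rw [h', zero_smul, MvPolynomial.coeff_zero]
  have hπ : MvPolynomial.aeval (fun x => π (MvPolynomial.X x)) = π :=
    MvPolynomial.algHom_ext fun x => by rw [MvPolynomial.aeval_X]
  rw [coeff_transl_eq_aeval, hπ, hpoly, map_sum, Gam, LinearMap.comp_apply, LinearMap.comp_apply,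
    projCoaction, LinearMap.comp_apply, LinearMap.comp_apply, Finsupp.lmapDomain_apply,
    Finsupp.mapDomain_single, hco]
  simp only [map_sum, map_smul, LinearMap.lTensor_tmul, LinearMap.rTensor_tmul,
    LinearEquiv.coe_coe, TensorProduct.lid_tmul, Finsupp.finsetSum_apply, Finsupp.smul_apply]
  refine Finset.sum_congr rfl fun q _ => ?_
  congr 1
  have hp : S.projPop (Finsupp.single q.2 1) γ = if q.2 = S.popIncl γ then 1 else 0 := by
    change Finsupp.single q.2 (1 : ℝ) (S.popIncl γ) = _
    rw [Finsupp.single_apply]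
  rw [hp]
  split_ifs
  · simp
  · simp

theorem End_apply_eq_sum (Γ : Module.End ℝ S.TPop) (v : S.TPop) (γ : S.Pop) :
    Γ v γ = v.sum fun β t => t * Γ (Finsupp.single β 1) γ := by
  have : v = v.sum fun β t => t • Finsupp.single β 1 := by simp
  conv_lhs => rw [this]
  rw [Finsupp.sum, map_sum, Finsupp.finsetSum_apply]
  refine Finset.sum_congr rfl fun β _ => ?_
  rw [map_smul, Finsupp.smul_apply, smul_eq_mul]

/-- The matrix product is a coefficient of one translation substituted into another. The projection
to `TPop` does no harm: for `γ` in `Pop`, all intermediate multi-indices stay in `Pop`. -/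
theorem Gam_mul (w₁ w₂ : S.MPlus ⊕ Fin d → ℝ) :
    S.Gam (MvPolynomial.aeval w₁) * S.Gam (MvPolynomial.aeval w₂) =
      S.Gam (MvPolynomial.aeval (S.compParam w₁ w₂)) := by
  classical
  refine Finsupp.lhom_ext' fun β => LinearMap.ext_ring (Finsupp.ext fun γ => ?_)
  have ha := S.hasSubst_shiftedCoord w₂
  change S.Gam (MvPolynomial.aeval w₁) (S.Gam (MvPolynomial.aeval w₂) (Finsupp.single β 1)) γ =
    S.Gam (MvPolynomial.aeval (S.compParam w₁ w₂)) (Finsupp.single β 1) γ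
  rw [End_apply_eq_sum, Gam_single]
  simp only [MvPolynomial.aeval_X]
  have hy : S.shiftedCoord (fun x => S.compParam w₁ w₂ x) = fun n =>
      MvPowerSeries.subst (S.image (S.shiftedCoord w₂)) (S.shiftedCoord w₁ n) := by
    ext1 n
    rw [subst_shiftedCoord]
  rw [hy, ← subst_transl S ha, coeff_subst_image S ha, ← finsum_subtype_eq (s := S.Pop)]
  · rw [finsum_eq_sum_of_support_subset
      (s := (S.Gam (MvPolynomial.aeval w₂) (Finsupp.single β 1)).support)]
    · refine Finset.sum_congr rfl fun δ _ => ?_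
      dsimp only
      rw [Gam_single, Gam_single, mul_comm]
      simp only [MvPolynomial.aeval_X]
    · intro δ hδ
      rw [Finset.mem_coe, Finsupp.mem_support_iff, Gam_single]
      simp only [MvPolynomial.aeval_X]
      exact right_ne_zero_of_mul hδ
  · intro δ hδ
    exact S.mem_Pop_of_coeff_transl_ne_zero w₁ (left_ne_zero_of_mul hδ) γ.2

theorem Gam_zero : S.Gam (MvPolynomial.aeval 0) = 1 := by
  classical
  refine Finsupp.lhom_ext' fun β => LinearMap.ext_ring (Finsupp.ext fun γ => ?_)
  change S.Gam (MvPolynomial.aeval 0) (Finsupp.single β 1) γ = Finsupp.single β (1 : ℝ) γ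
  rw [Gam_single]
  simp only [MvPolynomial.aeval_X]
  have hy : S.shiftedCoord (fun x => (0 : S.MPlus ⊕ Fin d → ℝ) x) =
      fun n => MvPowerSeries.X (Sum.inr n) := by
    ext1 n
    exact S.shiftedCoord_zero n
  rw [hy, coeff_transl_X, MvPolynomial.coeff_monomial, Finsupp.single_apply]
  by_cases h : β = γ
  · rw [if_pos h, if_pos (congrArg Subtype.val h).symm]; rfl
  · rw [if_neg h, if_neg fun h' => h (Subtype.ext h').symm]; rfl

theorem exists_aeval_eq (π : S.TPlus →ₐ[ℝ] ℝ) : ∃ w, π = MvPolynomial.aeval w :=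
  ⟨_, MvPolynomial.aeval_unique π⟩

theorem isGroup_G [Finite Λ] :
    ∃ H : Subgroup (Module.End ℝ S.TPop)ˣ, S.G = Units.val '' (H : Set (Module.End ℝ S.TPop)ˣ) := by
  have hmul : ∀ {Γ Γ'}, Γ ∈ S.G → Γ' ∈ S.G → Γ * Γ' ∈ S.G := by
    rintro _ _ ⟨π, rfl⟩ ⟨π', rfl⟩
    obtain ⟨w, rfl⟩ := S.exists_aeval_eq π
    obtain ⟨w', rfl⟩ := S.exists_aeval_eq π'
    exact ⟨_, (S.Gam_mul w w').symm⟩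
  have hleft : ∀ {Γ}, Γ ∈ S.G → ∃ Γ' ∈ S.G, Γ' * Γ = 1 := by
    rintro _ ⟨π, rfl⟩
    obtain ⟨w, rfl⟩ := S.exists_aeval_eq π
    obtain ⟨w', hw'⟩ := S.exists_compParam_eq_zero w
    exact ⟨_, ⟨MvPolynomial.aeval w', rfl⟩, by rw [Gam_mul, hw', Gam_zero]⟩
  -- The left inverse has a left inverse itself, which must be `Γ`.
  have hinv : ∀ {Γ}, Γ ∈ S.G → ∃ Γ' ∈ S.G, Γ' * Γ = 1 ∧ Γ * Γ' = 1 := fun {Γ} hΓ => by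
    obtain ⟨Γ', hΓ', h⟩ := hleft hΓ
    obtain ⟨Γ'', -, h'⟩ := hleft hΓ'
    exact ⟨Γ', hΓ', h, left_inv_eq_right_inv h' h ▸ h'⟩
  refine ⟨{ carrier := {u | u.val ∈ S.G}
            mul_mem' := fun {u v} hu hv => hmul hu hv
            one_mem' := ⟨_, S.Gam_zero⟩
            inv_mem' := fun {u} hu => ?_ }, ?_⟩
  · obtain ⟨Γ', hΓ', h, -⟩ := hinv hu
    change (u⁻¹).val ∈ S.G
    rwa [Units.inv_eq_of_mul_eq_one_left h]
  · ext Γ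
    refine ⟨fun hΓ => ?_, ?_⟩
    · obtain ⟨Γ', hΓ', h, h'⟩ := hinv hΓ
      exact ⟨⟨Γ, Γ', h', h⟩, hΓ, rfl⟩
    · rintro ⟨u, hu, rfl⟩
      exact hu

/-! ### Triangularity and grading of the model space -/

theorem hom_lt_of_Gam_sub_one (π : S.TPlus →ₐ[ℝ] ℝ) (β γ : S.Pop)
    (h : (S.Gam π - 1 : Module.End ℝ S.TPop) (Finsupp.single β 1) γ ≠ 0) :
    S.hom γ < S.hom β := by
  classical
  by_contra hlt
  refine h ?_
  rw [LinearMap.sub_apply, Finsupp.sub_apply, Gam_single, coeff_transl_of_not_lt S _ hlt,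
    MvPolynomial.coeff_monomial, Module.End.one_apply, Finsupp.single_apply]
  by_cases h : β = γ
  · rw [if_pos h, if_pos (congrArg Subtype.val h).symm, sub_self]
  · rw [if_neg h, if_neg fun h' => h (Subtype.ext h').symm, sub_self]

theorem iSup_graded (p : S.A → Prop) : ⨆ ν : S.A, ⨆ _ : p ν, S.graded ν =
    Finsupp.supported ℝ ℝ {β : S.Pop | ∃ ν, p ν ∧ S.hom β + S.η = ν} := by
  have : {β : S.Pop | ∃ ν : S.A, p ν ∧ S.hom β + S.η = ν} =
      ⋃ ν : {ν : S.A // p ν}, {β : S.Pop | S.hom β + S.η = ν.1} := by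
    ext β
    simp
  rw [this, Finsupp.supported_iUnion, iSup_subtype']
  rfl

theorem triangular_G (Γ : Module.End ℝ S.TPop) (hΓ : Γ ∈ S.G) (ν : S.A) (a : S.TPop)
    (ha : a ∈ S.graded ν) : Γ a - a ∈ ⨆ ν' : S.A, ⨆ _ : ν' < ν, S.graded ν' := by
  obtain ⟨π, rfl⟩ := hΓ
  rw [iSup_graded, Finsupp.mem_supported]
  intro γ hγ
  have hsub : S.Gam π a - a = (S.Gam π - 1 : Module.End ℝ S.TPop) a := rfl
  rw [Finset.mem_coe, Finsupp.mem_support_iff, hsub, End_apply_eq_sum] at hγ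
  obtain ⟨β, hβ, hne⟩ := Finset.exists_ne_zero_of_sum_ne_zero hγ
  have hβν : S.hom β + S.η = ν := (Finsupp.mem_supported _ _).1 ha hβ
  have hlt := S.hom_lt_of_Gam_sub_one π β γ (right_ne_zero_of_mul hne)
  refine ⟨⟨S.hom γ + S.η, Or.inr ⟨γ.1, γ.2, rfl⟩⟩, ?_, rfl⟩
  rw [← Subtype.coe_lt_coe, ← hβν]
  exact add_lt_add_left hlt _

theorem isInternal_graded : DirectSum.IsInternal S.graded := by
  refine DirectSum.isInternal_submodule_of_iSupIndep_of_iSup_eq_top ?_ ?_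
  · intro ν
    rw [iSup_graded]
    refine Finsupp.disjoint_supported_supported (Set.disjoint_left.2 fun β hβ hβ' => ?_)
    obtain ⟨ν', hν', h⟩ := hβ'
    exact hν' (Subtype.ext (h.symm.trans hβ))
  · have h := S.iSup_graded fun _ => True
    simp only [iSup_pos] at h
    rw [h, eq_top_iff]
    intro a _
    rw [Finsupp.mem_supported]
    exact fun β _ => ⟨⟨S.hom β + S.η, Or.inr ⟨β.1, β.2, rfl⟩⟩, trivial, rfl⟩

end Setting

end MultiIndexRS

end

open MultiIndexRS in
theorem mainTheorem5 {d : ℕ} {Λ : Type*} [Finite Λ] (S : Setting d Λ) :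
    -- for every β, only finitely many terms of the coaction are non-zero
    (∀ β : S.All, {q : (MI S.MPlus × (Fin d → ℕ)) × S.All |
      S.actCoeffPlus q.1.1 q.1.2 β q.2 ≠ 0}.Finite) ∧
    IsRegularityStructure S.A S.graded S.G ∧
    (∀ (π : S.TPlus →ₐ[ℝ] ℝ) (β γ : S.Pop),
      (S.Gam π - 1 : Module.End ℝ S.TPop) (Finsupp.single β 1) γ ≠ 0 → S.hom γ < S.hom β) :=
  ⟨S.finite_actCoeffPlus,
    { bddBelow := S.bddBelow_A
      locallyFinite := fun _ b => (S.finite_A_le b).subset fun _ ht => ⟨ht.1, ht.2.2⟩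
      isInternal := S.isInternal_graded
      isGroup := S.isGroup_G
      triangular := S.triangular_G },
    S.hom_lt_of_Gam_sub_one⟩
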